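/- **Setting.** There are $N\ge 1$ players. Player $i$ has a compact convex action set $\Omega_i\subseteq\mathbb R^{n_i}$; write $X:=\Omega_1\times\cdots\times\Omega_N$, and use Euclidean norms and inner products. An online game is a sequence of games $\Gamma_t$, $t\ge 1$, with costs $J_{i,t}(x_i,x_{-i})$ and a shared constraint $g_t(x):=\sum_{i=1}^N g_{i,t}(x_i)\le \mathbf 0_m$, where $g_{i,t}$ takes values in $\mathbb R^m$. *Assumptions on the online game.* For all $i$, all $t\ge1$ and all components $j$: $J_{i,t}(\cdot,x_{-i})$ is convex and differentiable on $\Omega_i$ for all $x\in X$; $g_{ij,t}$ is convex and differentiable on $\Omega_i$; there are constants $L,M>0$, independent of $t$, such that for all $x\in X$: $\|x_i\|<L$, $|J_{i,t}(x)|\le L$, $\|g_{i,t}(x_i)\|\le L$, $\|\nabla_iJ_{i,t}(x)\|\le M$ and $\|\nabla g_{ij,t}(x_i)\|\le M$; and Slater's condition holds: there is $x\in X$ with $g_t(x)<0$ in every component. *Communication graph.* A connected undirected graph on the players has a weighted adjacency matrix $A=(a_{ij})$ with $A=A^\top$, $A\mathbf 1_N=\mathbf 1_N$, $a_{ii}>0$,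 and, for $i\ne j$, $a_{ij}>0$ if $i,j$ are adjacent and $a_{ij}=0$ otherwise. *Mirror maps.* For each $i$, $\phi_i$ is differentiable and strongly convex on $\Omega_i$, and $D_{\phi_i}(\xi,\zeta)=\phi_i(\xi)-\phi_i(\zeta)-\langle\nabla\phi_i(\zeta),\xi-\zeta\rangle$ is Lipschitz in $\xi\in\Omega_i$, with a constant independent of $\zeta\in\Omega_i$. *Algorithm.* Given stepsizes $\alpha_t,\beta_t,\gamma_t$, start from any $x_{i,1}\in\Omega_i$ and $\lambda_{i,1}=\mathbf 0_m$. For $t\ge1$ and every $i$ put $\tilde\lambda_{i,t}=\sum_{j=1}^N a_{ij}\lambda_{j,t}$ and $$x_{i,t+1}=\arg\min_{y\in\Omega_i}\Big\{\alpha_t\Big\langle y,\ \nabla_iJ_{i,t}(x_t)+\sum_{j=1}^m(\tilde\lambda_{i,t})_j\nabla g_{ij,t}(x_{i,t})\Big\rangle+D_{\phi_i}(y,x_{i,t})\Big\},$$ $$\lambda_{i,t+1}=\big[\tilde\lambda_{i,t}+\gamma_t\big(g_{i,t}(x_{i,t})-\beta_t\tilde\lambda_{i,t}\big)\big]_+,$$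 where $[\cdot]_+$ is the projection onto $\mathbb R^m_+$. *Limit game.* $\Gamma$ is a game with costs $J_i$ and shared constraint $g(x):=\sum_{i=1}^N g_i(x_i)\le\mathbf 0_m$. Each $J_i(\cdot,x_{-i})$ is convex and differentiable on $\Omega_i$, the map $F(x)=\mathrm{col}(\nabla_1J_1(x),\dots,\nabla_NJ_N(x))$ is $\mu$-strongly monotone on $X$ for some $\mu>0$, and Slater's condition holds (there is $x\in X$ with $g(x)<0$ in every component). Let $x^*$ be the variational generalized Nash equilibrium of $\Gamma$: $x^*\in\Omega:=\{x\in X: g(x)\le \mathbf 0_m\}$ and $\langle F(x^*),x-x^*\rangle\ge0$ for all $x\in\Omega$. Put $$H_{i,t}:=\sup_{x\in X}\|\nabla_iJ_{i,t}(x)-\nabla_iJ_i(x)\|,\qquad K_t:=\sup_{x\in X}\|g_t(x)-g(x)\|.$$ **Theorem.** Suppose that for some $p,q>0$, over $t\ge1$, $H_{i,t}=\mathcal O(t^{-p})$ for every $i$ and $K_t=\mathcal O(t^{-q})$. Let $\alpha_t=t^{-b_1}$, $\beta_t=t^{-b_2}$, $\gamma_t=t^{-(1-b_2)}$ for $t\ge1$,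 with $0<2b_2<b_1<1$ and $b_2<q$. Then there is a constant $C>0$ such that for every sequence $(x_t)_{t\ge1}$ generated by the algorithm, and every $T\ge1$, the averaged play $\overline x_T:=\frac1T\sum_{t=1}^Tx_t$ satisfies $$\|\overline x_T-x^*\|^2\le C\,T^{-\min\{1-b_1,\ b_1-2b_2,\ b_2,\ p,\ q-b_2\}}.$$ -/

import Mathlib

open scoped ENNReal

noncomputable section

namespace OnlineGame

/-- The Euclidean space `ℝ^k`. -/
abbrev Vec (k : ℕ) : Type := EuclideanSpace ℝ (Fin k)

/-- Joint actions `x = col(x_1, …, x_N)` with `x_i ∈ ℝ^{n_i}`, with the Euclidean inner product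
`⟨x, y⟩ = ∑ i, ⟨x_i, y_i⟩` and the Euclidean norm. -/
abbrev Joint {N : ℕ} (n : Fin N → ℕ) : Type := PiLp 2 (fun i : Fin N => Vec (n i))

variable {N : ℕ} {n : Fin N → ℕ} {m : ℕ}

/-- The joint action `(y, x_{-i})`: player `i` plays `y`, all the others play as in `x`. -/
def deviate (x : Joint n) (i : Fin N) (y : Vec (n i)) : Joint n :=
  WithLp.toLp 2 (Function.update (fun k => x k) i y)

/-- The product `Ω_1 × ⋯ × Ω_N` of the private action sets. -/
def prodSet (Ω : ∀ i : Fin N, Set (Vec (n i))) : Set (Joint n) :=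
  {x | ∀ i, x i ∈ Ω i}

/-- A game with a shared constraint: the cost functions `J_i` of the players and the private parts
`g_i : ℝ^{n_i} → ℝ^m` of the shared constraint `∑ i, g_i(x_i) ≤ 0`. -/
structure Game {N : ℕ} (n : Fin N → ℕ) (m : ℕ) where
  /-- The cost function of each player. -/
  J : Fin N → Joint n → ℝ
  /-- The private part of the shared constraint function of each player. -/
  g : ∀ i : Fin N, Vec (n i) → Vec m

/-- The shared constraint function `g(x) = ∑ i, g_i(x_i)`. -/
def Game.gSum (Γ : Game n m) (x : Joint n) : Vec m := ∑ i, Γ.g i (x i)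

/-- The strategy set: private action sets together with the shared constraint `g(x) ≤ 0`. -/
def Game.feasible (Γ : Game n m) (Ω : ∀ i : Fin N, Set (Vec (n i))) : Set (Joint n) :=
  {x | x ∈ prodSet Ω ∧ ∀ j, Γ.gSum x j ≤ 0}

/-- Slater's constraint qualification: some point of `Ω_1 × ⋯ × Ω_N` satisfies all the shared
inequality constraints strictly. In particular the strategy set is non-empty. -/
def Game.Slater (Γ : Game n m) (Ω : ∀ i : Fin N, Set (Vec (n i))) : Prop :=
  ∃ x ∈ prodSet Ω, ∀ j, Γ.gSum x j < 0

/-- `dJ i x` is the partial gradient `∇_i J_i(x)` at every `x ∈ Ω_1 × ⋯ × Ω_N`. Only the values of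
`J_i(·, x_{-i})` on `Ω_i` matter (derivatives at boundary points are taken within `Ω_i`); gradients
of functions that are differentiable on a neighbourhood of `Ω_i` are a special case. -/
def Game.HasCostGradients (Γ : Game n m) (Ω : ∀ i : Fin N, Set (Vec (n i)))
    (dJ : ∀ i : Fin N, Joint n → Vec (n i)) : Prop :=
  ∀ i, ∀ x ∈ prodSet Ω,
    HasGradientWithinAt (fun y => Γ.J i (deviate x i y)) (dJ i x) (Ω i) (x i)

/-- `dg i j y` is the gradient `∇ g_{ij}(y)` of the `j`-th component of `g_i`, for `y ∈ Ω_i`. -/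
def Game.HasConstraintGradients (Γ : Game n m) (Ω : ∀ i : Fin N, Set (Vec (n i)))
    (dg : ∀ i : Fin N, Fin m → Vec (n i) → Vec (n i)) : Prop :=
  ∀ i j, ∀ y ∈ Ω i, HasGradientWithinAt (fun z => Γ.g i z j) (dg i j y) (Ω i) y

/-- Each cost `J_i(·, x_{-i})` is convex on `Ω_i`. -/
def Game.ConvexCosts (Γ : Game n m) (Ω : ∀ i : Fin N, Set (Vec (n i))) : Prop :=
  ∀ i, ∀ x ∈ prodSet Ω, ConvexOn ℝ (Ω i) (fun y => Γ.J i (deviate x i y))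

/-- Each component `g_{ij}` of the constraint functions is convex on `Ω_i`. -/
def Game.ConvexConstraints (Γ : Game n m) (Ω : ∀ i : Fin N, Set (Vec (n i))) : Prop :=
  ∀ i j, ConvexOn ℝ (Ω i) (fun y => Γ.g i y j)

/-- The pseudo-gradient mapping `F(x) = col(∇_1 J_1(x), …, ∇_N J_N(x))`. -/
def pseudoGradient (dJ : ∀ i : Fin N, Joint n → Vec (n i)) (x : Joint n) : Joint n :=
  WithLp.toLp 2 (fun i => dJ i x)

/-- `F` is `μ`-strongly monotone on `S`. -/
def StronglyMonotoneOn (F : Joint n → Joint n) (S : Set (Joint n)) (μ : ℝ) : Prop :=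
  ∀ x ∈ S, ∀ y ∈ S, μ * ‖x - y‖ ^ 2 ≤ inner ℝ (F x - F y) (x - y)

/-- `xs` is a variational generalized Nash equilibrium: a solution over the strategy set of the
variational inequality given by the pseudo-gradient mapping. -/
def Game.IsVariationalGNE (Γ : Game n m) (Ω : ∀ i : Fin N, Set (Vec (n i)))
    (dJ : ∀ i : Fin N, Joint n → Vec (n i)) (xs : Joint n) : Prop :=
  xs ∈ Γ.feasible Ω ∧ ∀ x ∈ Γ.feasible Ω, 0 ≤ inner ℝ (pseudoGradient dJ xs) (x - xs)

/-- The communication graph `G` is connected, and `A` is a symmetric weighted adjacency matrix of it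
with positive diagonal entries and with row sums one. -/
structure IsCommunicationMatrix (G : SimpleGraph (Fin N)) (A : Matrix (Fin N) (Fin N) ℝ) :
    Prop where
  connected : G.Connected
  pos_of_adj : ∀ i j, G.Adj i j → 0 < A i j
  zero_of_not_adj : ∀ i j, i ≠ j → ¬ G.Adj i j → A i j = 0
  diag_pos : ∀ i, 0 < A i i
  symm : A.transpose = A
  row_sum : ∀ i, ∑ j, A i j = 1

/-- The blanket assumption on the private action sets and on the online game `Γ_t`, `t ≥ 1`. -/
structure BlanketAssumption (Ω : ∀ i : Fin N, Set (Vec (n i))) (Γ : ℕ → Game n m)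
    (dJ : ℕ → ∀ i : Fin N, Joint n → Vec (n i))
    (dg : ℕ → ∀ i : Fin N, Fin m → Vec (n i) → Vec (n i)) : Prop where
  compact : ∀ i, IsCompact (Ω i)
  convex : ∀ i, Convex ℝ (Ω i)
  convex_costs : ∀ t, 1 ≤ t → (Γ t).ConvexCosts Ω
  convex_constraints : ∀ t, 1 ≤ t → (Γ t).ConvexConstraints Ω
  cost_gradients : ∀ t, 1 ≤ t → (Γ t).HasCostGradients Ω (dJ t)
  constraint_gradients : ∀ t, 1 ≤ t → (Γ t).HasConstraintGradients Ω (dg t)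
  bounded : ∃ L : ℝ, 0 < L ∧ (∀ i, ∀ y ∈ Ω i, ‖y‖ < L) ∧
    (∀ t, 1 ≤ t → ∀ i, ∀ x ∈ prodSet Ω, |(Γ t).J i x| ≤ L) ∧
    (∀ t, 1 ≤ t → ∀ i, ∀ y ∈ Ω i, ‖(Γ t).g i y‖ ≤ L)
  bounded_gradients : ∃ M : ℝ, 0 < M ∧
    (∀ t, 1 ≤ t → ∀ i, ∀ x ∈ prodSet Ω, ‖dJ t i x‖ ≤ M) ∧
    (∀ t, 1 ≤ t → ∀ i j, ∀ y ∈ Ω i, ‖dg t i j y‖ ≤ M)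
  slater : ∀ t, 1 ≤ t → (Γ t).Slater Ω

/-- The Bregman divergence of `φ`, where `dφ` is the gradient of `φ`. -/
def bregman {k : ℕ} (φ : Vec k → ℝ) (dφ : Vec k → Vec k) (ξ ζ : Vec k) : ℝ :=
  φ ξ - φ ζ - inner ℝ (dφ ζ) (ξ - ζ)

/-- Each `φ_i` is differentiable on `Ω_i` with gradient `dφ_i`, and `μ_i`-strongly convex there for
some `μ_i > 0`. -/
def IsMirrorMap (Ω : ∀ i : Fin N, Set (Vec (n i))) (φ : ∀ i : Fin N, Vec (n i) → ℝ)
    (dφ : ∀ i : Fin N, Vec (n i) → Vec (n i)) : Prop :=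
  ∀ i, (∀ ζ ∈ Ω i, HasGradientWithinAt (φ i) (dφ i ζ) (Ω i) ζ) ∧
    ∃ μ : ℝ, 0 < μ ∧ ∀ ξ ∈ Ω i, ∀ ζ ∈ Ω i,
      φ i ζ + inner ℝ (dφ i ζ) (ξ - ζ) + μ / 2 * ‖ξ - ζ‖ ^ 2 ≤ φ i ξ

/-- The Bregman divergences are Lipschitz in the first variable, uniformly in the second one. -/
def BregmanLipschitz (Ω : ∀ i : Fin N, Set (Vec (n i))) (φ : ∀ i : Fin N, Vec (n i) → ℝ)
    (dφ : ∀ i : Fin N, Vec (n i) → Vec (n i)) : Prop :=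
  ∃ K : ℝ, 0 < K ∧ ∀ i, ∀ ζ ∈ Ω i, ∀ ξ₁ ∈ Ω i, ∀ ξ₂ ∈ Ω i,
    |bregman (φ i) (dφ i) ξ₁ ζ - bregman (φ i) (dφ i) ξ₂ ζ| ≤ K * ‖ξ₁ - ξ₂‖

/-- The projection `[v]_+` onto the nonnegative orthant. -/
def posProj (v : Vec m) : Vec m := WithLp.toLp 2 (fun j => max (v j) 0)

/-- The stepsize `1 / t^b`, with value one at `t = 0`. -/
def stepsize (b : ℝ) (t : ℕ) : ℝ := if t = 0 then 1 else 1 / (t : ℝ) ^ b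

/-- The locally averaged multiplier `∑ j, a_{ij} λ_j`. -/
def mixed (A : Matrix (Fin N) (Fin N) ℝ) (lam : Fin N → Vec m) (i : Fin N) : Vec m :=
  ∑ j, A i j • lam j

/-- `(x_t, λ_t)`, `t ≥ 1`, is a run of the decentralized online primal-dual dynamic mirror descent
algorithm on the online game `Γ_t` with stepsizes `α_t`, `β_t`, `γ_t`. The start `x_1` is arbitrary,
and the values at time zero play no role. -/
structure IsRun (Ω : ∀ i : Fin N, Set (Vec (n i))) (Γ : ℕ → Game n m)
    (dJ : ℕ → ∀ i : Fin N, Joint n → Vec (n i))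
    (dg : ℕ → ∀ i : Fin N, Fin m → Vec (n i) → Vec (n i))
    (A : Matrix (Fin N) (Fin N) ℝ)
    (φ : ∀ i : Fin N, Vec (n i) → ℝ) (dφ : ∀ i : Fin N, Vec (n i) → Vec (n i))
    (α β γ : ℕ → ℝ) (x : ℕ → Joint n) (lam : ℕ → Fin N → Vec m) : Prop where
  init_primal : x 1 ∈ prodSet Ω
  init_dual : ∀ i, lam 1 i = 0
  primal_mem : ∀ t, 1 ≤ t → ∀ i, x (t + 1) i ∈ Ω i
  primal_min : ∀ t, 1 ≤ t → ∀ i,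
    IsMinOn
      (fun y : Vec (n i) =>
        α t * inner ℝ y (dJ t i (x t) + ∑ j, mixed A (lam t) i j • dg t i j (x t i)) +
          bregman (φ i) (dφ i) y (x t i))
      (Ω i) (x (t + 1) i)
  dual : ∀ t, 1 ≤ t → ∀ i,
    lam (t + 1) i = posProj (mixed A (lam t) i +
      γ t • ((Γ t).g i (x t i) - β t • mixed A (lam t) i))

/-- `H_i = sup ‖∇_i J_i(x) - ∇_i J'_i(x)‖` over `Ω_1 × ⋯ × Ω_N`, as an extended nonnegative real. -/
def gradGap (Ω : ∀ i : Fin N, Set (Vec (n i))) (dJ dJ' : ∀ i : Fin N, Joint n → Vec (n i))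
    (i : Fin N) : ℝ≥0∞ :=
  ⨆ x ∈ prodSet Ω, ‖dJ i x - dJ' i x‖ₑ

/-- `K = sup ‖g(x) - g'(x)‖` over `Ω_1 × ⋯ × Ω_N`, as an extended nonnegative real. -/
def constraintGap (Ω : ∀ i : Fin N, Set (Vec (n i))) (Γ Γ' : Game n m) : ℝ≥0∞ :=
  ⨆ x ∈ prodSet Ω, ‖Γ.gSum x - Γ'.gSum x‖ₑ

/-- `h_t = O(1 / t^r)` over `t ≥ 1`. -/
def HasRate (h : ℕ → ℝ≥0∞) (r : ℝ) : Prop :=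
  ∃ C : ℝ, 0 < C ∧ ∀ t : ℕ, 1 ≤ t → h t ≤ ENNReal.ofReal (C * (1 / (t : ℝ) ^ r))

/-- The averaged play `(1 / T) ∑_{t=1}^T x_t`. -/
def averagedPlay (x : ℕ → Joint n) (T : ℕ) : Joint n :=
  (1 / (T : ℝ)) • ∑ t ∈ Finset.Icc 1 T, x t

end OnlineGame

end

noncomputable section
namespace OnlineGame
variable {N : ℕ} {n : Fin N → ℕ} {m : ℕ}

/-! ### Power sums -/

/-! Write `u_{i,t}` for the mixed multipliers, `F` for the limit pseudo-gradient and `r` for the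
minimum in the exponent. Strong monotonicity bounds `μ‖x_t - x*‖² + ⟨F(x*), x_t - x*⟩` by `⟨F(x_t),
x_t - x*⟩`. The mirror step bounds this in turn by a Bregman telescope and small errors, minus the
pairing of `u_{i,t}` with `g_{i,t}(x_{i,t}) - g_{i,t}(x*_i)` (`IsRun.primal_step`). The obstacle is
that `⟨F(x*), x_t - x*⟩` may be negative, because the plays need not be feasible.

No KKT multiplier is needed to repair this. Slater's condition turns the variational inequality into
an exact penalty valid on all of `X` (`Game.exists_exact_penalty`). At the averaged play, Jensen's
inequality yields a vector `l ≥ 0` for which the sum over `t` of `⟨F(x*), x_t - x*⟩ + ⟨l, g(x_t)⟩`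
is nonnegative (`Game.exists_bounded_multiplier`). This `l` depends on the run and on `T`, but its
norm is bounded uniformly. The dual recursion has small regret against every fixed nonnegative
vector (`IsRun.sum_inner_sub_mixed_le`), so `u` can be exchanged for `l`. The remaining pairing of
`u` with `g_t(x*)` splits into the average multiplier, whose product with `g(x*)` is nonpositive,
and the disagreement, which is summable against `γ_t` because mixing contracts it
(`IsRun.sum_norm_dev_le`).

Since `γ_t β_t = 1/t`, the multipliers grow at most like `t^b₂`. Hence the primal error is of order
`t^(-(b₁ - 2b₂))` and the constraint drift of order `t^(-(q - b₂))`. Together with `β_t`, `γ_t` and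
the gradient drift, every error is at most a multiple of `t^(-r)`, and the telescope costs `T^b₁ ≤
T^(1-r)`. Division by `T` and Jensen's inequality for the squared norm give the rate. -/

lemma rpow_diff_ge {s : ℝ} (hs0 : 0 ≤ s) (hs1 : s ≤ 1) {t : ℝ} (ht : 1 ≤ t) :
    (t - 1) ^ s + s * t ^ (s - 1) ≤ t ^ s := by
  have ht0 : 0 < t := by linarith
  have hinv : 1 / t ≤ 1 := by rw [div_le_one ht0]; exact ht
  -- Bernoulli's inequality for exponents in `[0, 1]`, to be scaled by `t ^ s`.
  have h1 := rpow_one_add_le_one_add_mul_self (s := -(1 / t)) (by linarith) hs0 hs1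
  have h2 : (t - 1) ^ s = t ^ s * (1 + -(1 / t)) ^ s := by
    rw [← Real.mul_rpow ht0.le (by linarith)]
    congr 1
    field_simp
    ring
  have h3 : t ^ (s - 1) = t ^ s * (1 / t) := by
    rw [Real.rpow_sub_one ht0.ne']; ring
  rw [h2, h3]
  have := mul_le_mul_of_nonneg_left h1 (Real.rpow_nonneg ht0.le s)
  linarith

lemma sum_rpow_neg_le {r : ℝ} (hr0 : 0 ≤ r) (hr1 : r < 1) (T : ℕ) :
    ∑ t ∈ Finset.Icc 1 T, (t : ℝ) ^ (-r) ≤ 1 / (1 - r) * (T : ℝ) ^ (1 - r) := by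
  have hr : 0 < 1 - r := by linarith
  induction T with
  | zero => simp [Real.zero_rpow hr.ne']
  | succ T ih =>
    rw [Finset.sum_Icc_succ_top (by omega)]
    have h := rpow_diff_ge (s := 1 - r) hr.le (by linarith) (t := ((T + 1 : ℕ) : ℝ))
      (by push_cast; linarith [Nat.cast_nonneg (α := ℝ) T])
    have e1 : ((T + 1 : ℕ) : ℝ) - 1 = T := by push_cast; ring
    have e2 : 1 - r - 1 = -r := by ring
    rw [e1, e2] at h
    have h' := mul_le_mul_of_nonneg_left h (one_div_pos.2 hr).le
    rw [mul_add, ← mul_assoc, one_div_mul_cancel hr.ne', one_mul] at h'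
    linarith

/-- The left side is `(t - 1) * t ^ (-b)`. In the dual estimate this says that the contraction by `1
- 1/t` pays for the growth of the weight `1/γ_t = t ^ (1 - b)`. -/
lemma rpow_neg_sub_le {b : ℝ} (hb0 : 0 ≤ b) {t : ℝ} (ht : 1 ≤ t) :
    t ^ (1 - b) - t ^ (-b) ≤ (t - 1) ^ (1 - b) := by
  have ht0 : 0 < t := by linarith
  rcases ht.eq_or_lt with rfl | ht1
  · simpa using Real.rpow_nonneg (le_refl (0 : ℝ)) (1 - b)
  have e1 : t ^ (1 - b) = t * t ^ (-b) := by
    rw [sub_eq_add_neg, Real.rpow_add ht0, Real.rpow_one]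
  have e2 : (t - 1) ^ (1 - b) = (t - 1) * (t - 1) ^ (-b) := by
    rw [sub_eq_add_neg 1 b, Real.rpow_add (by linarith), Real.rpow_one]
  rw [e1, e2]
  have : t ^ (-b) ≤ (t - 1) ^ (-b) :=
    Real.rpow_le_rpow_of_nonpos (by linarith) (by linarith) (by linarith)
  nlinarith

lemma stepsize_eq (b : ℝ) {t : ℕ} (ht : 1 ≤ t) : stepsize b t = (t : ℝ) ^ (-b) := by
  rw [stepsize, if_neg (by omega), Real.rpow_neg (Nat.cast_nonneg t), one_div]

lemma stepsize_pos (b : ℝ) {t : ℕ} (ht : 1 ≤ t) : 0 < stepsize b t := by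
  rw [stepsize_eq b ht]
  exact Real.rpow_pos_of_pos (by exact_mod_cast ht) _

lemma rpow_neg_anti {a b : ℝ} (hab : b ≤ a) {t : ℕ} (ht : 1 ≤ t) :
    (t : ℝ) ^ (-a) ≤ (t : ℝ) ^ (-b) :=
  Real.rpow_le_rpow_of_exponent_le (by exact_mod_cast ht) (by linarith)

/-! ### Convexity and the mirror descent step -/

/-- Gradients exist only within `S`, so the function is restricted to the segment from `x` to `y`,
where the one-sided derivative at `0` is at most the slope. -/
lemma gradient_inequality {k : ℕ} {S : Set (Vec k)} {f : Vec k → ℝ} {v x y : Vec k}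
    (hf : ConvexOn ℝ S f) (hd : HasGradientWithinAt f v S x) (hx : x ∈ S) (hy : y ∈ S) :
    f x + inner ℝ v (y - x) ≤ f y := by
  have hmap : ∀ s ∈ Set.Icc (0 : ℝ) 1, AffineMap.lineMap x y s ∈ S := fun s hs =>
    hf.1.segment_subset hx hy (by
      rw [segment_eq_image_lineMap]; exact ⟨s, hs, rfl⟩)
  have hconv : ConvexOn ℝ (Set.Icc (0 : ℝ) 1) (f ∘ AffineMap.lineMap x y) :=
    (hf.comp_affineMap (AffineMap.lineMap x y)).subset hmap (convex_Icc 0 1)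
  have hd0 : HasDerivWithinAt (f ∘ AffineMap.lineMap x y) (inner ℝ v (y - x))
      (Set.Icc (0 : ℝ) 1) 0 := by
    have h1 : HasFDerivWithinAt f (InnerProductSpace.toDual ℝ (Vec k) v) S
        (AffineMap.lineMap x y (0 : ℝ)) := by
      simpa using hd.hasFDerivWithinAt
    have h2 : HasDerivWithinAt (AffineMap.lineMap x y : ℝ → Vec k) (y - x) (Set.Icc 0 1) 0 :=
      AffineMap.hasDerivWithinAt_lineMap
    simpa using h1.comp_hasDerivWithinAt 0 h2 hmap
  have h := hconv.le_slope_of_hasDerivWithinAt (x := 0) (y := 1) (by simp) (by simp) (by norm_num) hd0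
  simp [slope_def_field] at h
  linarith

lemma IsMinOn.inner_nonneg {k : ℕ} {S : Set (Vec k)} {f : Vec k → ℝ} {v x y : Vec k}
    (hS : Convex ℝ S) (hd : HasGradientWithinAt f v S x) (hx : x ∈ S) (hy : y ∈ S)
    (hmin : IsMinOn f S x) : 0 ≤ inner ℝ v (y - x) := by
  have h := hmin.localize.hasFDerivWithinAt_nonneg hd.hasFDerivWithinAt
    (sub_mem_posTangentConeAt_of_segment_subset (hS.segment_subset hx hy))
  simpa using h

/-- Optimality of `z` and the three-point identity for Bregman divergences give the telescoping
difference. The cost of evaluating at `x` instead of `z` is absorbed by strong convexity through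
Young's inequality. -/
lemma mirror_step {k : ℕ} {S : Set (Vec k)} (hS : Convex ℝ S) {φ : Vec k → ℝ}
    {dφ : Vec k → Vec k} {ν : ℝ} (hν : 0 < ν)
    (hd : ∀ ζ ∈ S, HasGradientWithinAt φ (dφ ζ) S ζ)
    (hsc : ∀ ξ ∈ S, ∀ ζ ∈ S, φ ζ + inner ℝ (dφ ζ) (ξ - ζ) + ν / 2 * ‖ξ - ζ‖ ^ 2 ≤ φ ξ)
    {a : ℝ} (ha : 0 < a) {G x z y : Vec k} (hx : x ∈ S) (hz : z ∈ S) (hy : y ∈ S)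
    (hmin : IsMinOn (fun y => a * inner ℝ y G + bregman φ dφ y x) S z) :
    inner ℝ (x - y) G ≤
      (bregman φ dφ y x - bregman φ dφ y z) / a + a * ‖G‖ ^ 2 / (2 * ν) := by
  have hgrad : HasGradientWithinAt (fun y => a * inner ℝ y G + bregman φ dφ y x)
      (a • G + (dφ z - dφ x)) S z := by
    rw [hasGradientWithinAt_iff_hasFDerivWithinAt]
    have h1 := (hd z hz).hasFDerivWithinAt
    have h2 : HasFDerivWithinAt (fun y : Vec k => a * inner ℝ y G)
        (InnerProductSpace.toDual ℝ (Vec k) (a • G)) S z := by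
      have : (fun y : Vec k => a * inner ℝ y G) = InnerProductSpace.toDual ℝ (Vec k) (a • G) := by
        ext y
        simp [real_inner_comm]
      rw [this]
      exact (InnerProductSpace.toDual ℝ (Vec k) (a • G)).hasFDerivWithinAt
    have h3 : HasFDerivWithinAt (fun y : Vec k => inner ℝ (dφ x) (y - x))
        (InnerProductSpace.toDual ℝ (Vec k) (dφ x)) S z := by
      have : (fun y : Vec k => inner ℝ (dφ x) (y - x))
          = fun y => InnerProductSpace.toDual ℝ (Vec k) (dφ x) y - inner ℝ (dφ x) x := by
        ext y
        simp [inner_sub_right]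
      rw [this]
      exact (InnerProductSpace.toDual ℝ (Vec k) (dφ x)).hasFDerivWithinAt.sub_const _
    have h4 := h2.add ((h1.sub_const (φ x)).sub h3)
    rw [map_add, map_sub]
    exact h4
  have h0 := IsMinOn.inner_nonneg hS hgrad hz hy hmin
  have hs := hsc z hz x hx
  rw [inner_add_left, inner_smul_left, inner_sub_left] at h0
  simp only [RCLike.conj_to_real] at h0
  have hc : inner ℝ G (x - z) ≤ ‖G‖ * ‖z - x‖ := by
    rw [norm_sub_rev]; exact real_inner_le_norm _ _
  have hsq : a * (‖G‖ * ‖z - x‖) ≤ ν / 2 * ‖z - x‖ ^ 2 + a * (a * ‖G‖ ^ 2 / (2 * ν)) := by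
    have : 0 ≤ (ν * ‖z - x‖ - a * ‖G‖) ^ 2 / (2 * ν) := by positivity
    have e : (ν * ‖z - x‖ - a * ‖G‖) ^ 2 / (2 * ν) = ν / 2 * ‖z - x‖ ^ 2
        + a * (a * ‖G‖ ^ 2 / (2 * ν)) - a * (‖G‖ * ‖z - x‖) := by
      field_simp; ring
    linarith
  have hc' := mul_le_mul_of_nonneg_left hc ha.le
  have key : a * inner ℝ (x - y) G ≤ (bregman φ dφ y x - bregman φ dφ y z)
      + a * (a * ‖G‖ ^ 2 / (2 * ν)) := by
    have e1 : inner ℝ (x - y) G = inner ℝ G (x - z) - inner ℝ G (y - z) := by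
      rw [real_inner_comm, ← inner_sub_right]; congr 1; abel
    have e2 : inner ℝ (dφ x) (y - x) = inner ℝ (dφ x) (y - z) + inner ℝ (dφ x) (z - x) := by
      rw [← inner_add_right]; congr 1; abel
    simp only [bregman]
    rw [e1, e2, mul_sub]
    linarith
  rw [div_add' _ _ _ ha.ne', le_div_iff₀ ha]
  linarith

lemma bregman_nonneg {k : ℕ} {S : Set (Vec k)} {φ : Vec k → ℝ} {dφ : Vec k → Vec k}
    {ν : ℝ} (hν : 0 < ν)
    (hsc : ∀ ξ ∈ S, ∀ ζ ∈ S, φ ζ + inner ℝ (dφ ζ) (ξ - ζ) + ν / 2 * ‖ξ - ζ‖ ^ 2 ≤ φ ξ)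
    {x y : Vec k} (hx : x ∈ S) (hy : y ∈ S) : 0 ≤ bregman φ dφ y x := by
  have h := hsc y hy x hx
  have : 0 ≤ ν / 2 * ‖y - x‖ ^ 2 := by positivity
  simp only [bregman]
  linarith

/-! ### The projection onto the nonnegative orthant -/

lemma posProj_apply (v : Vec m) (j : Fin m) : posProj v j = max (v j) 0 := rfl

lemma norm_posProj_sub_le (v : Vec m) {w : Vec m} (hw : ∀ j, 0 ≤ w j) :
    ‖posProj v - w‖ ≤ ‖v - w‖ := by
  rw [EuclideanSpace.norm_eq, EuclideanSpace.norm_eq]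
  apply Real.sqrt_le_sqrt
  refine Finset.sum_le_sum fun j _ => ?_
  simp only [PiLp.sub_apply, posProj_apply, Real.norm_eq_abs, sq_abs]
  rcases le_total (v j) 0 with h | h
  · rw [max_eq_right h]; nlinarith [hw j]
  · rw [max_eq_left h]

lemma norm_posProj_le (v : Vec m) : ‖posProj v‖ ≤ ‖v‖ := by
  simpa using norm_posProj_sub_le v (w := 0) (by simp)

/-! ### Mixing with the communication matrix -/

lemma IsCommunicationMatrix.nonneg {G : SimpleGraph (Fin N)} {A : Matrix (Fin N) (Fin N) ℝ}
    (hA : IsCommunicationMatrix G A) (i j : Fin N) : 0 ≤ A i j := by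
  by_cases hij : i = j
  · subst hij; exact (hA.diag_pos i).le
  by_cases h : G.Adj i j
  · exact (hA.pos_of_adj i j h).le
  · exact (hA.zero_of_not_adj i j hij h).ge

lemma IsCommunicationMatrix.col_sum {G : SimpleGraph (Fin N)} {A : Matrix (Fin N) (Fin N) ℝ}
    (hA : IsCommunicationMatrix G A) (j : Fin N) : ∑ i, A i j = 1 := by
  rw [← hA.row_sum j]
  refine Finset.sum_congr rfl fun i _ => ?_
  conv_lhs => rw [← hA.symm]
  rfl

/-- Each row is a probability vector, and the right side adds up the variances of `v` under the
rows. Unit column sums identify the total second moment with `∑ i, v i ^ 2`. -/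
lemma IsCommunicationMatrix.sum_sq_sub {G : SimpleGraph (Fin N)} {A : Matrix (Fin N) (Fin N) ℝ}
    (hA : IsCommunicationMatrix G A) (v : Fin N → ℝ) :
    ∑ i, v i ^ 2 - ∑ i, (∑ j, A i j * v j) ^ 2
      = 1 / 2 * ∑ i, ∑ j, ∑ k, A i j * A i k * (v j - v k) ^ 2 := by
  have h : ∀ i, ∑ j, ∑ k, A i j * A i k * (v j - v k) ^ 2
      = 2 * ∑ j, A i j * v j ^ 2 - 2 * (∑ j, A i j * v j) ^ 2 := by
    intro i
    have e : ∀ j k, A i j * A i k * (v j - v k) ^ 2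
        = (A i j * v j ^ 2) * A i k + A i j * (A i k * v k ^ 2)
          - 2 * ((A i j * v j) * (A i k * v k)) := fun j k => by ring
    simp only [e, Finset.sum_add_distrib, Finset.sum_sub_distrib, ← Finset.mul_sum,
      ← Finset.sum_mul, hA.row_sum i]
    ring
  simp only [h, Finset.sum_sub_distrib, ← Finset.mul_sum]
  rw [Finset.sum_comm (f := fun i j => A i j * v j ^ 2)]
  simp only [← Finset.sum_mul, hA.col_sum]
  ring_nf

lemma IsCommunicationMatrix.sum_sq_lt {G : SimpleGraph (Fin N)} {A : Matrix (Fin N) (Fin N) ℝ}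
    (hA : IsCommunicationMatrix G A) {v : Fin N → ℝ} (hv : ∑ i, v i = 0)
    (hv1 : ∑ i, v i ^ 2 = 1) : ∑ i, (∑ j, A i j * v j) ^ 2 < 1 := by
  have hid := hA.sum_sq_sub v
  have hnn : ∀ i j k, 0 ≤ A i j * A i k * (v j - v k) ^ 2 := fun i j k =>
    mul_nonneg (mul_nonneg (hA.nonneg _ _) (hA.nonneg _ _)) (sq_nonneg _)
  by_contra! hcon
  have hz : ∑ i, ∑ j, ∑ k, A i j * A i k * (v j - v k) ^ 2 = 0 := by
    refine le_antisymm (by linarith) ?_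
    exact Finset.sum_nonneg fun i _ => Finset.sum_nonneg fun j _ =>
      Finset.sum_nonneg fun k _ => hnn i j k
  have hadj : ∀ i j, G.Adj i j → v i = v j := by
    intro i j hij
    rw [Finset.sum_eq_zero_iff_of_nonneg (fun i _ => Finset.sum_nonneg fun j _ =>
      Finset.sum_nonneg fun k _ => hnn i j k)] at hz
    have h1 := hz i (Finset.mem_univ _)
    rw [Finset.sum_eq_zero_iff_of_nonneg (fun j _ =>
      Finset.sum_nonneg fun k _ => hnn i j k)] at h1
    -- The triple `(i, i, j)` is where the positive diagonal enters: its weight `A i i * A i j` is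
    -- nonzero, which forces `v i = v j` across an edge.
    have h2 := h1 i (Finset.mem_univ _)
    rw [Finset.sum_eq_zero_iff_of_nonneg (fun k _ => hnn i i k)] at h2
    have h3 := h2 j (Finset.mem_univ _)
    have : A i i * A i j ≠ 0 := (mul_pos (hA.diag_pos i) (hA.pos_of_adj i j hij)).ne'
    have h4 : (v i - v j) ^ 2 = 0 := (mul_eq_zero.1 h3).resolve_left this
    exact sub_eq_zero.1 (pow_eq_zero_iff (two_ne_zero) |>.1 h4)
  have hall : ∀ i j, v i = v j := by
    intro i j
    obtain ⟨w⟩ := hA.connected.preconnected i j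
    induction w with
    | nil => rfl
    | cons h _ ih => exact (hadj _ _ h).trans ih
  obtain ⟨i₀⟩ := hA.connected.nonempty
  have hN : (0 : ℝ) < N := by exact_mod_cast i₀.pos
  have h0 : v i₀ = 0 := by
    have : ∑ i, v i = N * v i₀ := by simp [hall _ i₀]
    rw [this] at hv
    exact (mul_eq_zero.1 hv).resolve_left hN.ne'
  have : ∑ i, v i ^ 2 = 0 := Finset.sum_eq_zero fun i _ => by rw [hall i i₀, h0]; norm_num
  linarith

/-- Compactness of the unit sphere of mean-zero vectors upgrades the strict inequality to a uniform
factor, and homogeneity extends it to all mean-zero vectors. -/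
lemma IsCommunicationMatrix.exists_contraction {G : SimpleGraph (Fin N)}
    {A : Matrix (Fin N) (Fin N) ℝ} (hA : IsCommunicationMatrix G A) :
    ∃ σ : ℝ, 0 ≤ σ ∧ σ < 1 ∧ ∀ v : Fin N → ℝ, ∑ i, v i = 0 →
      ∑ i, (∑ j, A i j * v j) ^ 2 ≤ σ ^ 2 * ∑ i, v i ^ 2 := by
  set K : Set (Fin N → ℝ) := {v | ∑ i, v i = 0 ∧ ∑ i, v i ^ 2 = 1} with hK
  have hKc : IsCompact K := by
    refine Metric.isCompact_of_isClosed_isBounded ?_ ?_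
    · exact (isClosed_eq (by fun_prop) continuous_const).inter
        (isClosed_eq (by fun_prop) continuous_const)
    · refine (Metric.isBounded_closedBall (x := (0 : Fin N → ℝ)) (r := 1)).subset fun v hv => ?_
      rw [mem_closedBall_zero_iff, pi_norm_le_iff_of_nonneg zero_le_one]
      intro i
      have h1 : v i ^ 2 ≤ ∑ i, v i ^ 2 :=
        Finset.single_le_sum (f := fun i => v i ^ 2) (fun i _ => sq_nonneg _) (Finset.mem_univ i)
      rw [hv.2] at h1
      rw [Real.norm_eq_abs]
      exact (sq_le_one_iff_abs_le_one _).1 h1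
  obtain ⟨s, hs0, hs1, hs⟩ : ∃ s : ℝ, 0 ≤ s ∧ s < 1 ∧
      ∀ v ∈ K, ∑ i, (∑ j, A i j * v j) ^ 2 ≤ s := by
    -- With a single player the sphere is empty.
    rcases K.eq_empty_or_nonempty with he | hne
    · exact ⟨0, le_rfl, one_pos, by simp [he]⟩
    · obtain ⟨v, hv, hmax⟩ := hKc.exists_isMaxOn hne
        (f := fun v : Fin N → ℝ => ∑ i, (∑ j, A i j * v j) ^ 2) (by fun_prop)
      exact ⟨_, Finset.sum_nonneg fun i _ => sq_nonneg _, hA.sum_sq_lt hv.1 hv.2,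
        fun w hw => hmax hw⟩
  refine ⟨√s, Real.sqrt_nonneg _, by rw [Real.sqrt_lt' one_pos]; simpa using hs1, fun v hv => ?_⟩
  rw [Real.sq_sqrt hs0]
  rcases (Finset.sum_nonneg fun i _ => sq_nonneg (v i) : 0 ≤ ∑ i, v i ^ 2).eq_or_lt with h0 | hpos
  · have hz : ∀ i, v i = 0 := by
      intro i
      have := (Finset.sum_eq_zero_iff_of_nonneg (fun i _ => sq_nonneg (v i))).1 h0.symm i
        (Finset.mem_univ _)
      simpa using this
    simp [hz]
  · set c := √(∑ i, v i ^ 2) with hc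
    have hc0 : 0 < c := Real.sqrt_pos.2 hpos
    have hc2 : c ^ 2 = ∑ i, v i ^ 2 := Real.sq_sqrt hpos.le
    have hw := hs (fun i => c⁻¹ * v i) ⟨by rw [← Finset.mul_sum, hv, mul_zero], by
      simp only [mul_pow, ← Finset.mul_sum]
      rw [← hc2, ← mul_pow, inv_mul_cancel₀ hc0.ne', one_pow]⟩
    have e : ∀ i, ∑ j, A i j * (c⁻¹ * v j) = c⁻¹ * ∑ j, A i j * v j := fun i => by
      rw [Finset.mul_sum]; exact Finset.sum_congr rfl fun j _ => by ring
    simp only [e, mul_pow, ← Finset.mul_sum] at hw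
    rw [← hc2]
    rw [inv_pow, inv_mul_le_iff₀ (by positivity)] at hw
    linarith

lemma mixed_apply (A : Matrix (Fin N) (Fin N) ℝ) (lam : Fin N → Vec m) (i : Fin N) (k : Fin m) :
    mixed A lam i k = ∑ j, A i j * lam j k := by
  simp [mixed]

lemma IsCommunicationMatrix.mixed_nonneg {G : SimpleGraph (Fin N)}
    {A : Matrix (Fin N) (Fin N) ℝ} (hA : IsCommunicationMatrix G A) {lam : Fin N → Vec m}
    (h : ∀ i k, 0 ≤ lam i k) (i : Fin N) (k : Fin m) : 0 ≤ mixed A lam i k := by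
  rw [mixed_apply]
  exact Finset.sum_nonneg fun j _ => mul_nonneg (hA.nonneg i j) (h j k)

lemma IsCommunicationMatrix.mixed_sub {G : SimpleGraph (Fin N)}
    {A : Matrix (Fin N) (Fin N) ℝ} (hA : IsCommunicationMatrix G A) (lam : Fin N → Vec m)
    (w : Vec m) (i : Fin N) : mixed A lam i - w = ∑ j, A i j • (lam j - w) := by
  simp only [mixed, smul_sub, Finset.sum_sub_distrib, ← Finset.sum_smul, hA.row_sum, one_smul]

lemma IsCommunicationMatrix.norm_mixed_le {G : SimpleGraph (Fin N)}
    {A : Matrix (Fin N) (Fin N) ℝ} (hA : IsCommunicationMatrix G A) {lam : Fin N → Vec m}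
    {B : ℝ} (h : ∀ i, ‖lam i‖ ≤ B) (i : Fin N) : ‖mixed A lam i‖ ≤ B := by
  calc ‖mixed A lam i‖ ≤ ∑ j, ‖A i j • lam j‖ := norm_sum_le _ _
    _ ≤ ∑ j, A i j * B := Finset.sum_le_sum fun j _ => by
        rw [norm_smul, Real.norm_of_nonneg (hA.nonneg i j)]
        exact mul_le_mul_of_nonneg_left (h j) (hA.nonneg i j)
    _ = B := by rw [← Finset.sum_mul, hA.row_sum, one_mul]

lemma IsCommunicationMatrix.sum_norm_mixed_sub_sq_le {G : SimpleGraph (Fin N)}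
    {A : Matrix (Fin N) (Fin N) ℝ} (hA : IsCommunicationMatrix G A) (lam : Fin N → Vec m)
    (w : Vec m) : ∑ i, ‖mixed A lam i - w‖ ^ 2 ≤ ∑ i, ‖lam i - w‖ ^ 2 := by
  have hconv : ConvexOn ℝ Set.univ (fun v : Vec m => ‖v‖ ^ 2) :=
    convexOn_univ_norm.pow (fun _ _ => norm_nonneg _) 2
  calc ∑ i, ‖mixed A lam i - w‖ ^ 2 ≤ ∑ i, ∑ j, A i j * ‖lam j - w‖ ^ 2 :=
        Finset.sum_le_sum fun i _ => by
          rw [hA.mixed_sub]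
          exact hconv.map_sum_le (fun j _ => hA.nonneg i j) (hA.row_sum i)
            (fun _ _ => Set.mem_univ _)
    _ = ∑ j, ‖lam j - w‖ ^ 2 := by
        rw [Finset.sum_comm]
        simp only [← Finset.sum_mul, hA.col_sum, one_mul]

/-- The average of the multipliers over the players. -/
def avg (lam : Fin N → Vec m) : Vec m := (1 / (N : ℝ)) • ∑ i, lam i

/-- The deviations of the multipliers from their average. -/
def dev (lam : Fin N → Vec m) : PiLp 2 (fun _ : Fin N => Vec m) :=
  WithLp.toLp 2 (fun i => lam i - avg lam)

lemma dev_apply (lam : Fin N → Vec m) (i : Fin N) : dev lam i = lam i - avg lam := rfl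

lemma dev_zero : dev (fun _ : Fin N => (0 : Vec m)) = 0 := by
  ext i; simp [dev_apply, avg]

lemma dev_add (a b : Fin N → Vec m) : dev (fun i => a i + b i) = dev a + dev b := by
  ext i k
  simp only [dev_apply, avg, Finset.sum_add_distrib, smul_add, PiLp.add_apply, PiLp.sub_apply]
  ring

lemma avg_nonneg {lam : Fin N → Vec m} (h : ∀ i k, 0 ≤ lam i k) (k : Fin m) :
    0 ≤ avg lam k := by
  simp only [avg, PiLp.smul_apply, smul_eq_mul, WithLp.ofLp_sum, Finset.sum_apply]
  exact mul_nonneg (by positivity) (Finset.sum_nonneg fun i _ => h i k)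

lemma norm_avg_le (hN : 0 < N) {lam : Fin N → Vec m} {B : ℝ} (h : ∀ i, ‖lam i‖ ≤ B) :
    ‖avg lam‖ ≤ B := by
  have hN' : (0 : ℝ) < N := by exact_mod_cast hN
  rw [avg, norm_smul, Real.norm_of_nonneg (by positivity)]
  have : ‖∑ i, lam i‖ ≤ N * B := by
    refine (norm_sum_le _ _).trans ((Finset.sum_le_sum fun i _ => h i).trans ?_)
    simp
  calc 1 / (N : ℝ) * ‖∑ i, lam i‖ ≤ 1 / (N : ℝ) * (N * B) := by gcongr
    _ = B := by field_simp

lemma norm_dev_le (hN : 0 < N) {lam : Fin N → Vec m} {B : ℝ} (hB : 0 ≤ B)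
    (h : ∀ i, ‖lam i‖ ≤ B) : ‖dev lam‖ ≤ 2 * N * B := by
  have hN' : (1 : ℝ) ≤ N := by exact_mod_cast hN
  rw [PiLp.norm_eq_of_L2]
  apply Real.sqrt_le_iff.2 ⟨by positivity, ?_⟩
  calc ∑ i, ‖dev lam i‖ ^ 2 ≤ ∑ i : Fin N, (2 * B) ^ 2 := Finset.sum_le_sum fun i _ => by
        have h1 : ‖dev lam i‖ ≤ 2 * B := by
          rw [dev_apply]
          refine (norm_sub_le _ _).trans ?_
          linarith [h i, norm_avg_le hN h]
        gcongr
    _ = N * (2 * B) ^ 2 := by simp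
    _ ≤ (2 * N * B) ^ 2 := by
        have : (2 * N * B) ^ 2 = N * (N * (2 * B) ^ 2) := by ring
        rw [this]
        exact le_mul_of_one_le_left (by positivity) hN'

lemma norm_sq_eq_sum {v : Vec m} : ‖v‖ ^ 2 = ∑ k, v k ^ 2 := by
  rw [EuclideanSpace.norm_sq_eq]; simp

lemma sum_dev_apply (hN : 0 < N) (lam : Fin N → Vec m) (k : Fin m) : ∑ i, dev lam i k = 0 := by
  have hN' : (N : ℝ) ≠ 0 := by exact_mod_cast hN.ne'
  simp [dev_apply, avg, mul_inv_cancel_left₀ hN']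

lemma IsCommunicationMatrix.avg_mixed {G : SimpleGraph (Fin N)}
    {A : Matrix (Fin N) (Fin N) ℝ} (hA : IsCommunicationMatrix G A) (lam : Fin N → Vec m) :
    avg (mixed A lam) = avg lam := by
  unfold avg mixed
  rw [Finset.sum_comm]
  simp only [← Finset.sum_smul, hA.col_sum, one_smul]

/-- Mixing preserves the average and acts on each of the `m` coordinates separately, so the scalar
contraction applies coordinatewise. -/
lemma IsCommunicationMatrix.exists_norm_dev_mixed_le {G : SimpleGraph (Fin N)}
    {A : Matrix (Fin N) (Fin N) ℝ} (hA : IsCommunicationMatrix G A) :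
    ∃ σ : ℝ, 0 ≤ σ ∧ σ < 1 ∧ ∀ lam : Fin N → Vec m, ‖dev (mixed A lam)‖ ≤ σ * ‖dev lam‖ := by
  obtain ⟨σ, h0, h1, h⟩ := hA.exists_contraction
  obtain ⟨i₀⟩ := hA.connected.nonempty
  refine ⟨σ, h0, h1, fun lam => ?_⟩
  refine le_of_sq_le_sq ?_ (by positivity)
  rw [mul_pow, PiLp.norm_sq_eq_of_L2, PiLp.norm_sq_eq_of_L2]
  simp only [norm_sq_eq_sum]
  rw [Finset.sum_comm, Finset.sum_comm (f := fun i k => dev lam i k ^ 2), Finset.mul_sum]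
  refine Finset.sum_le_sum fun k _ => ?_
  have e : ∀ i, dev (mixed A lam) i k = ∑ j, A i j * dev lam j k := fun i => by
    rw [dev_apply, hA.avg_mixed, hA.mixed_sub]
    simp [dev_apply]
  simp only [e]
  exact h _ (sum_dev_apply i₀.pos lam k)

/-! ### The limit constraint and the exact penalty -/

lemma convex_prodSet {Ω : ∀ i : Fin N, Set (Vec (n i))} (hΩ : ∀ i, Convex ℝ (Ω i)) :
    Convex ℝ (prodSet Ω) := fun _ hx _ hy _ _ ha hb hab i => hΩ i (hx i) (hy i) ha hb hab

lemma Game.gSum_apply (Γ : Game n m) (x : Joint n) (j : Fin m) :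
    Γ.gSum x j = ∑ i, Γ.g i (x i) j := by
  simp [Game.gSum]

lemma Game.ConvexConstraints.convexOn_gSum {Γ : Game n m} {Ω : ∀ i : Fin N, Set (Vec (n i))}
    (hΩ : ∀ i, Convex ℝ (Ω i)) (h : Γ.ConvexConstraints Ω) (j : Fin m) :
    ConvexOn ℝ (prodSet Ω) (fun x => Γ.gSum x j) := by
  refine ⟨convex_prodSet hΩ, fun x hx y hy a b ha hb hab => ?_⟩
  simp only [Game.gSum_apply, smul_eq_mul, Finset.mul_sum, ← Finset.sum_add_distrib]
  exact Finset.sum_le_sum fun i _ => (h i j).2 (hx i) (hy i) ha hb hab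

lemma norm_le_of_enorm_le_ofReal {E : Type*} [NormedAddCommGroup E] {v : E} {c : ℝ} (hc : 0 ≤ c)
    (h : ‖v‖ₑ ≤ ENNReal.ofReal c) : ‖v‖ ≤ c := by
  rw [← ofReal_norm] at h
  exact (ENNReal.ofReal_le_ofReal_iff hc).1 h

lemma HasRate.exists_norm_grad_sub_le {Ω : ∀ i : Fin N, Set (Vec (n i))}
    {dJ : ℕ → ∀ i : Fin N, Joint n → Vec (n i)} {dJlim : ∀ i : Fin N, Joint n → Vec (n i)}
    {i : Fin N} {p : ℝ} (h : HasRate (fun t => gradGap Ω (dJ t) dJlim i) p) :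
    ∃ C : ℝ, 0 ≤ C ∧ ∀ t : ℕ, 1 ≤ t → ∀ x ∈ prodSet Ω,
      ‖dJ t i x - dJlim i x‖ ≤ C * (t : ℝ) ^ (-p) := by
  obtain ⟨C, hC, h⟩ := h
  refine ⟨C, hC.le, fun t ht x hx => ?_⟩
  rw [Real.rpow_neg (Nat.cast_nonneg t), ← one_div]
  refine norm_le_of_enorm_le_ofReal (by positivity) (le_trans ?_ (h t ht))
  exact le_iSup₂ (f := fun x (_ : x ∈ prodSet Ω) => ‖dJ t i x - dJlim i x‖ₑ) x hx

lemma HasRate.exists_norm_gSum_sub_le {Ω : ∀ i : Fin N, Set (Vec (n i))}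
    {Γ : ℕ → Game n m} {Γlim : Game n m} {q : ℝ}
    (h : HasRate (fun t => constraintGap Ω (Γ t) Γlim) q) :
    ∃ C : ℝ, 0 ≤ C ∧ ∀ t : ℕ, 1 ≤ t → ∀ x ∈ prodSet Ω,
      ‖(Γ t).gSum x - Γlim.gSum x‖ ≤ C * (t : ℝ) ^ (-q) := by
  obtain ⟨C, hC, h⟩ := h
  refine ⟨C, hC.le, fun t ht x hx => ?_⟩
  rw [Real.rpow_neg (Nat.cast_nonneg t), ← one_div]
  refine norm_le_of_enorm_le_ofReal (by positivity) (le_trans ?_ (h t ht))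
  exact le_iSup₂ (f := fun x (_ : x ∈ prodSet Ω) => ‖(Γ t).gSum x - Γlim.gSum x‖ₑ) x hx

/-- The limit constraint inherits convexity as a pointwise limit of convex functions. -/
lemma convexOn_gSum_limit {Ω : ∀ i : Fin N, Set (Vec (n i))} (hΩ : ∀ i, Convex ℝ (Ω i))
    {Γ : ℕ → Game n m} {Γlim : Game n m} (hconv : ∀ t, 1 ≤ t → (Γ t).ConvexConstraints Ω)
    {q C : ℝ} (hq : 0 < q) (h : ∀ t : ℕ, 1 ≤ t → ∀ x ∈ prodSet Ω,
      ‖(Γ t).gSum x - Γlim.gSum x‖ ≤ C * (t : ℝ) ^ (-q)) (j : Fin m) :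
    ConvexOn ℝ (prodSet Ω) (fun x => Γlim.gSum x j) := by
  have hlim : ∀ x ∈ prodSet Ω, Filter.Tendsto (fun t => (Γ t).gSum x j) Filter.atTop
      (nhds (Γlim.gSum x j)) := by
    intro x hx
    have h0 : Filter.Tendsto (fun t : ℕ => C * (t : ℝ) ^ (-q)) Filter.atTop (nhds 0) := by
      simpa using ((tendsto_rpow_neg_atTop hq).comp tendsto_natCast_atTop_atTop).const_mul C
    rw [tendsto_iff_norm_sub_tendsto_zero]
    refine squeeze_zero' (Filter.Eventually.of_forall fun _ => norm_nonneg _) ?_ h0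
    filter_upwards [Filter.eventually_ge_atTop 1] with t ht
    exact (PiLp.norm_apply_le ((Γ t).gSum x - Γlim.gSum x) j).trans (h t ht x hx)
  have hX := convex_prodSet hΩ
  refine ⟨hX, fun x hx y hy a b ha hb hab => ?_⟩
  refine le_of_tendsto_of_tendsto (hlim _ (hX hx hy ha hb hab))
    (((hlim x hx).const_smul a).add ((hlim y hy).const_smul b)) ?_
  filter_upwards [Filter.eventually_ge_atTop 1] with t ht
  exact ((hconv t ht).convexOn_gSum hΩ j).2 hx hy ha hb hab

/-- Moving `x` towards a Slater point by a fraction proportional to its violation makes it feasible.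
The variational inequality holds there, and the move changes the linear term by at most a multiple
of the violation. -/
lemma Game.exists_exact_penalty {Γ : Game n m} {Ω : ∀ i : Fin N, Set (Vec (n i))}
    (hg : ∀ j, ConvexOn ℝ (prodSet Ω) (fun x => Γ.gSum x j)) (hX : Convex ℝ (prodSet Ω))
    {R : ℝ} (hR : ∀ x ∈ prodSet Ω, ∀ y ∈ prodSet Ω, ‖x - y‖ ≤ R)
    (hslater : Γ.Slater Ω) {F xs : Joint n}
    (hF : ∀ x ∈ Γ.feasible Ω, 0 ≤ inner ℝ F (x - xs)) :
    ∃ c : ℝ, 0 ≤ c ∧ ∀ x ∈ prodSet Ω,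
      0 ≤ inner ℝ F (x - xs) + c * ∑ j, max (Γ.gSum x j) 0 := by
  obtain ⟨z, hz, hzneg⟩ := hslater
  obtain ⟨ε, hε, hzε⟩ : ∃ ε : ℝ, 0 < ε ∧ ∀ j, Γ.gSum z j ≤ -ε := by
    rcases isEmpty_or_nonempty (Fin m) with hm | hm
    · exact ⟨1, one_pos, fun j => hm.elim j⟩
    · obtain ⟨j₀, hj₀⟩ := Finite.exists_max (fun j => Γ.gSum z j)
      exact ⟨-Γ.gSum z j₀, by linarith [hzneg j₀], fun j => by linarith [hj₀ j]⟩
  have hR0 : 0 ≤ R := (norm_nonneg _).trans (hR z hz z hz)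
  refine ⟨‖F‖ * R / ε, by positivity, fun x hx => ?_⟩
  set v := ∑ j, max (Γ.gSum x j) 0 with hv
  have hv0 : 0 ≤ v := Finset.sum_nonneg fun j _ => le_max_right _ _
  have hgv : ∀ j, Γ.gSum x j ≤ v := fun j => (le_max_left _ _).trans
    (Finset.single_le_sum (f := fun j => max (Γ.gSum x j) 0) (fun j _ => le_max_right _ _)
      (Finset.mem_univ j))
  have hvε : 0 < v + ε := by linarith
  -- Chosen so that `(1 - θ) * v = θ * ε`: the slack of `z` exactly offsets the violation of `x`.
  set θ := v / (v + ε) with hθ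
  have hθ0 : 0 ≤ θ := by positivity
  have hθ1 : θ ≤ 1 := by rw [hθ, div_le_one hvε]; linarith
  have hθv : θ ≤ v / ε := div_le_div_of_nonneg_left hv0 hε (by linarith)
  have hmem : (1 - θ) • x + θ • z ∈ Γ.feasible Ω := by
    refine ⟨hX hx hz (by linarith) hθ0 (by ring), fun j => ?_⟩
    have h1 := (hg j).2 hx hz (by linarith : 0 ≤ 1 - θ) hθ0 (by ring)
    simp only [smul_eq_mul] at h1
    have h2 : (1 - θ) * v - θ * ε = 0 := by rw [hθ]; field_simp; ring
    have h3 := mul_le_mul_of_nonneg_left (hgv j) (by linarith : 0 ≤ 1 - θ)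
    have h4 := mul_le_mul_of_nonneg_left (hzε j) hθ0
    linarith
  have h0 := hF _ hmem
  have e : (1 - θ) • x + θ • z - xs = (x - xs) + θ • (z - x) := by
    rw [sub_smul, one_smul, smul_sub]; abel
  rw [e, inner_add_right, inner_smul_right] at h0
  have h1 : inner ℝ F (z - x) ≤ ‖F‖ * R := (real_inner_le_norm _ _).trans
    (mul_le_mul_of_nonneg_left (hR z hz x hx) (norm_nonneg _))
  have h2 : θ * inner ℝ F (z - x) ≤ v / ε * (‖F‖ * R) :=
    (mul_le_mul_of_nonneg_left h1 hθ0).trans (mul_le_mul_of_nonneg_right hθv (by positivity))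
  have h3 : ‖F‖ * R / ε * v = v / ε * (‖F‖ * R) := by ring
  linarith

lemma averagedPlay_eq (x : ℕ → Joint n) (T : ℕ) :
    averagedPlay x T = ∑ t ∈ Finset.Icc 1 T, (1 / (T : ℝ)) • x t := by
  rw [averagedPlay, Finset.smul_sum]

lemma sum_Icc_one_div {T : ℕ} (hT : 1 ≤ T) : ∑ _t ∈ Finset.Icc 1 T, 1 / (T : ℝ) = 1 := by
  have : (T : ℝ) ≠ 0 := by positivity
  simp [this]

/-- The exact penalty at the averaged play, in terms of a bounded multiplier that may depend on
the play. -/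
lemma Game.exists_bounded_multiplier {Γ : Game n m} {Ω : ∀ i : Fin N, Set (Vec (n i))}
    (hg : ∀ j, ConvexOn ℝ (prodSet Ω) (fun x => Γ.gSum x j)) (hX : Convex ℝ (prodSet Ω))
    {R : ℝ} (hR : ∀ x ∈ prodSet Ω, ∀ y ∈ prodSet Ω, ‖x - y‖ ≤ R)
    (hslater : Γ.Slater Ω) {F xs : Joint n}
    (hF : ∀ x ∈ Γ.feasible Ω, 0 ≤ inner ℝ F (x - xs)) :
    ∃ Λ : ℝ, 0 ≤ Λ ∧ ∀ (x : ℕ → Joint n), (∀ t, 1 ≤ t → x t ∈ prodSet Ω) →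
      ∀ T : ℕ, 1 ≤ T → ∃ l : Vec m, (∀ j, 0 ≤ l j) ∧ ‖l‖ ≤ Λ ∧
        0 ≤ ∑ t ∈ Finset.Icc 1 T, (inner ℝ F (x t - xs) + inner ℝ l (Γ.gSum (x t))) := by
  obtain ⟨c, hc, hpen⟩ := Γ.exists_exact_penalty hg hX hR hslater hF
  refine ⟨√(m * c ^ 2), Real.sqrt_nonneg _, fun x hx T hT => ?_⟩
  have hT0 : (0 : ℝ) < T := by exact_mod_cast hT
  set a : Fin m → ℝ := fun j => ∑ t ∈ Finset.Icc 1 T, Γ.gSum (x t) j with ha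
  have hl : ∀ j, (WithLp.toLp 2 (fun j => if 0 < a j then c else 0) : Vec m) j
    = if 0 < a j then c else 0 := fun j => rfl
  -- The penalty weight `c` is put on exactly those components whose accumulated constraint value is
  -- positive, so the linear pairing reproduces the positive parts.
  refine ⟨WithLp.toLp 2 (fun j => if 0 < a j then c else 0), fun j => ?_, ?_, ?_⟩
  · rw [hl]; split_ifs <;> simp [hc]
  · apply Real.le_sqrt_of_sq_le
    rw [norm_sq_eq_sum]
    refine (Finset.sum_le_sum (g := fun _ => c ^ 2) fun j _ => ?_).trans (by simp)
    rw [hl]; split_ifs <;> simp [sq_nonneg]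
  · have hmem : ∀ t ∈ Finset.Icc 1 T, x t ∈ prodSet Ω := fun t ht =>
      hx t (Finset.mem_Icc.1 ht).1
    have hw : ∀ t ∈ Finset.Icc 1 T, 0 ≤ 1 / (T : ℝ) := fun _ _ => by positivity
    have havg : averagedPlay x T ∈ prodSet Ω := by
      rw [averagedPlay_eq]
      exact hX.sum_mem hw (sum_Icc_one_div hT) hmem
    have hga : ∀ j, Γ.gSum (averagedPlay x T) j ≤ 1 / (T : ℝ) * a j := fun j => by
      rw [averagedPlay_eq, ha, Finset.mul_sum]
      exact (hg j).map_sum_le hw (sum_Icc_one_div hT) hmem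
    have hin : inner ℝ F (averagedPlay x T - xs)
        = 1 / (T : ℝ) * ∑ t ∈ Finset.Icc 1 T, inner ℝ F (x t - xs) := by
      have : averagedPlay x T - xs = (1 / (T : ℝ)) • ∑ t ∈ Finset.Icc 1 T, (x t - xs) := by
        rw [Finset.sum_sub_distrib, smul_sub, averagedPlay]
        congr 1
        rw [Finset.sum_const, Nat.card_Icc, Nat.add_sub_cancel, ← Nat.cast_smul_eq_nsmul ℝ,
          smul_smul, one_div_mul_cancel hT0.ne', one_smul]
      rw [this, inner_smul_right, inner_sum]
    have hlg : ∑ t ∈ Finset.Icc 1 T,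
        inner ℝ (WithLp.toLp 2 (fun j => if 0 < a j then c else 0) : Vec m) (Γ.gSum (x t))
        = c * ∑ j, max (a j) 0 := by
      rw [← inner_sum, PiLp.inner_apply, Finset.mul_sum]
      refine Finset.sum_congr rfl fun j _ => ?_
      have : (∑ t ∈ Finset.Icc 1 T, Γ.gSum (x t)) j = a j := by simp [ha]
      rw [this]
      rcases lt_or_ge 0 (a j) with h | h
      · simp [h, h.le, mul_comm]
      · simp [h, not_lt.2 h]
    have h0 := hpen _ havg
    rw [hin] at h0
    have h1 : ∑ j, max (Γ.gSum (averagedPlay x T) j) 0 ≤ 1 / (T : ℝ) * ∑ j, max (a j) 0 := by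
      rw [Finset.mul_sum]
      refine Finset.sum_le_sum fun j _ => max_le ((hga j).trans ?_) (by positivity)
      exact mul_le_mul_of_nonneg_left (le_max_left _ _) (by positivity)
    have h2 := mul_le_mul_of_nonneg_left h1 hc
    rw [Finset.sum_add_distrib, hlg]
    have h3 : 0 ≤ 1 / (T : ℝ) * (∑ t ∈ Finset.Icc 1 T, inner ℝ F (x t - xs)
      + c * ∑ j, max (a j) 0) := by linarith
    exact nonneg_of_mul_nonneg_right h3 (by positivity)

/-! ### Estimates along a run -/

section Run

variable {G : SimpleGraph (Fin N)} {A : Matrix (Fin N) (Fin N) ℝ}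
  {Ω : ∀ i : Fin N, Set (Vec (n i))} {Γ : ℕ → Game n m}
  {dJ : ℕ → ∀ i : Fin N, Joint n → Vec (n i)}
  {dg : ℕ → ∀ i : Fin N, Fin m → Vec (n i) → Vec (n i)}
  {φ : ∀ i : Fin N, Vec (n i) → ℝ} {dφ : ∀ i : Fin N, Vec (n i) → Vec (n i)}
  {α β γ : ℕ → ℝ} {x : ℕ → Joint n} {lam : ℕ → Fin N → Vec m} {b L : ℝ}

lemma IsRun.mem (h : IsRun Ω Γ dJ dg A φ dφ α β γ x lam) {t : ℕ} (ht : 1 ≤ t) :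
    x t ∈ prodSet Ω := by
  obtain ⟨s, rfl⟩ := Nat.exists_eq_add_of_le' ht
  rcases Nat.eq_zero_or_pos s with rfl | hs
  · exact h.init_primal
  · exact fun i => h.primal_mem s hs i

lemma IsRun.lam_nonneg (h : IsRun Ω Γ dJ dg A φ dφ α β γ x lam) {t : ℕ} (ht : 1 ≤ t)
    (i : Fin N) (k : Fin m) : 0 ≤ lam t i k := by
  obtain ⟨s, rfl⟩ := Nat.exists_eq_add_of_le' ht
  rcases Nat.eq_zero_or_pos s with rfl | hs
  · simp [h.init_dual]
  · rw [h.dual s hs]; exact le_max_right _ _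

lemma stepsize_mul_stepsize (b : ℝ) {t : ℕ} (ht : 1 ≤ t) :
    stepsize (1 - b) t * stepsize b t = 1 / t := by
  have ht0 : (0 : ℝ) < t := by exact_mod_cast ht
  rw [stepsize_eq _ ht, stepsize_eq _ ht, ← Real.rpow_add ht0, one_div, ← Real.rpow_neg_one]
  congr 1; ring

lemma stepsize_mul_rpow (b : ℝ) {t : ℕ} (ht : 1 ≤ t) :
    stepsize b t * (t : ℝ) ^ b = 1 := by
  have ht0 : (0 : ℝ) < t := by exact_mod_cast ht
  rw [stepsize_eq _ ht, ← Real.rpow_add ht0]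
  simp

/-- Because `γ_t β_t = 1/t` and `γ_t = t^b / t`, the update before projection is a convex
combination, with weights `1 - 1/t` and `1/t`, of the mixed multiplier and `t^b • g`. Both have norm
at most `L * t^b`. -/
lemma IsRun.norm_lam_le (hA : IsCommunicationMatrix G A)
    (hL : ∀ t, 1 ≤ t → ∀ i, ∀ y ∈ Ω i, ‖(Γ t).g i y‖ ≤ L) (hL0 : 0 ≤ L) (hb : 0 ≤ b)
    (h : IsRun Ω Γ dJ dg A φ dφ α (stepsize b) (stepsize (1 - b)) x lam) {t : ℕ} (ht : 1 ≤ t) :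
    ∀ i, ‖lam t i‖ ≤ L * (t : ℝ) ^ b := by
  induction t, ht using Nat.le_induction with
  | base => intro i; simp [h.init_dual, hL0]
  | succ t ht ih =>
    intro i
    have ht1 : (1 : ℝ) ≤ t := by exact_mod_cast ht
    have hγβ := stepsize_mul_stepsize b ht
    have hγ := stepsize_pos (1 - b) ht
    have hinv : 1 / (t : ℝ) ≤ 1 := by rw [div_le_one (by linarith)]; exact ht1
    have e : mixed A (lam t) i + stepsize (1 - b) t •
        ((Γ t).g i (x t i) - stepsize b t • mixed A (lam t) i)
        = (1 - 1 / (t : ℝ)) • mixed A (lam t) i + stepsize (1 - b) t • (Γ t).g i (x t i) := by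
      rw [← hγβ, smul_sub, sub_smul, one_smul, smul_smul]; abel
    have hu := hA.norm_mixed_le ih i
    have hg := hL t ht i _ (h.mem ht i)
    rw [h.dual t ht, e]
    refine (norm_posProj_le _).trans ((norm_add_le _ _).trans ?_)
    rw [norm_smul, norm_smul, Real.norm_of_nonneg (by linarith), Real.norm_of_nonneg hγ.le]
    have e2 : stepsize (1 - b) t = 1 / (t : ℝ) * (t : ℝ) ^ b := by
      rw [← hγβ, mul_assoc, stepsize_mul_rpow b ht, mul_one]
    calc (1 - 1 / (t : ℝ)) * ‖mixed A (lam t) i‖ + stepsize (1 - b) t * ‖(Γ t).g i (x t i)‖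
        ≤ (1 - 1 / (t : ℝ)) * (L * (t : ℝ) ^ b) + stepsize (1 - b) t * L :=
          add_le_add (mul_le_mul_of_nonneg_left hu (by linarith))
            (mul_le_mul_of_nonneg_left hg hγ.le)
      _ = L * (t : ℝ) ^ b := by rw [e2]; ring
      _ ≤ L * ((t + 1 : ℕ) : ℝ) ^ b := by
          refine mul_le_mul_of_nonneg_left ?_ hL0
          exact Real.rpow_le_rpow (by linarith) (by push_cast; linarith) hb

lemma IsRun.norm_dual_direction_le (hA : IsCommunicationMatrix G A)
    (hL : ∀ t, 1 ≤ t → ∀ i, ∀ y ∈ Ω i, ‖(Γ t).g i y‖ ≤ L) (hL0 : 0 ≤ L) (hb : 0 ≤ b)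
    (h : IsRun Ω Γ dJ dg A φ dφ α (stepsize b) (stepsize (1 - b)) x lam) {t : ℕ} (ht : 1 ≤ t)
    (i : Fin N) : ‖(Γ t).g i (x t i) - stepsize b t • mixed A (lam t) i‖ ≤ 2 * L := by
  have hβ := stepsize_pos b ht
  have h1 := hL t ht i _ (h.mem ht i)
  have h2 := mul_le_mul_of_nonneg_left
    (hA.norm_mixed_le (h.norm_lam_le hA hL hL0 hb ht) i) hβ.le
  have h3 : stepsize b t * (L * (t : ℝ) ^ b) = L := by
    rw [mul_left_comm, stepsize_mul_rpow b ht, mul_one]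
  refine (norm_sub_le _ _).trans ?_
  rw [norm_smul, Real.norm_of_nonneg hβ.le]
  linarith

/-- The disagreement of the multipliers is summable up to the sum of the dual stepsizes. -/
lemma IsRun.sum_norm_dev_le (hA : IsCommunicationMatrix G A)
    (hL : ∀ t, 1 ≤ t → ∀ i, ∀ y ∈ Ω i, ‖(Γ t).g i y‖ ≤ L) (hL0 : 0 ≤ L) (hb : 0 ≤ b)
    {σ : ℝ} (hσ : ∀ l : Fin N → Vec m, ‖dev (mixed A l)‖ ≤ σ * ‖dev l‖)
    (h : IsRun Ω Γ dJ dg A φ dφ α (stepsize b) (stepsize (1 - b)) x lam) (T : ℕ) :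
    (1 - σ) * ∑ t ∈ Finset.Icc 1 T, ‖dev (lam t)‖ + ‖dev (lam (T + 1))‖
      ≤ 2 * N * (2 * L) * ∑ t ∈ Finset.Icc 1 T, stepsize (1 - b) t := by
  obtain ⟨i₀⟩ := hA.connected.nonempty
  induction T with
  | zero =>
    have : lam (0 + 1) = fun _ => 0 := funext h.init_dual
    simp [this, dev_zero]
  | succ T ih =>
    rw [Finset.sum_Icc_succ_top (by omega), Finset.sum_Icc_succ_top (by omega)]
    have ht : 1 ≤ T + 1 := by omega
    have hγ := stepsize_pos (1 - b) ht
    -- The mixed multiplier lies in the orthant, so projecting cannot increase the distance of the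
    -- update from it.
    have hmix : ∀ i k, 0 ≤ mixed A (lam (T + 1)) i k :=
      hA.mixed_nonneg (fun i k => h.lam_nonneg ht i k)
    have hstep : ∀ i, ‖lam (T + 1 + 1) i - mixed A (lam (T + 1)) i‖
        ≤ stepsize (1 - b) (T + 1) * (2 * L) := fun i => by
      rw [h.dual (T + 1) ht]
      refine (norm_posProj_sub_le _ (hmix i)).trans ?_
      rw [add_sub_cancel_left, norm_smul, Real.norm_of_nonneg hγ.le]
      exact mul_le_mul_of_nonneg_left (h.norm_dual_direction_le hA hL hL0 hb ht i) hγ.le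
    have hdev : dev (lam (T + 1 + 1)) = dev (mixed A (lam (T + 1)))
        + dev (fun i => lam (T + 1 + 1) i - mixed A (lam (T + 1)) i) := by
      rw [← dev_add]; congr 1; ext i : 1; abel
    have h1 : ‖dev (lam (T + 1 + 1))‖ ≤ σ * ‖dev (lam (T + 1))‖
        + 2 * N * (stepsize (1 - b) (T + 1) * (2 * L)) := by
      rw [hdev]
      exact (norm_add_le _ _).trans (add_le_add (hσ _)
        (norm_dev_le i₀.pos (by positivity) hstep))
    linarith

/-- The regularisation gives a contraction, since `2⟨u, u - w⟩ ≥ ‖u - w‖² - ‖w‖²`; its price is the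
term `γβ‖w‖²`. -/
lemma norm_dual_step_sq_le {γ β L : ℝ} (hγ : 0 ≤ γ) (hβ : 0 ≤ β) {g u w : Vec m}
    (hw : ∀ k, 0 ≤ w k) (hd : ‖g - β • u‖ ≤ 2 * L) :
    ‖posProj (u + γ • (g - β • u)) - w‖ ^ 2 ≤ (1 - γ * β) * ‖u - w‖ ^ 2
      + 2 * γ * inner ℝ g (u - w) + γ * β * ‖w‖ ^ 2 + 4 * L ^ 2 * γ ^ 2 := by
  have h1 : ‖posProj (u + γ • (g - β • u)) - w‖ ^ 2 ≤ ‖(u - w) + γ • (g - β • u)‖ ^ 2 := by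
    have h := norm_posProj_sub_le (u + γ • (g - β • u)) hw
    have e : u + γ • (g - β • u) - w = (u - w) + γ • (g - β • u) := by abel
    rw [e] at h
    gcongr
  have h2 : ‖(u - w) + γ • (g - β • u)‖ ^ 2 = ‖u - w‖ ^ 2
      + 2 * γ * (inner ℝ g (u - w) - β * inner ℝ u (u - w)) + γ ^ 2 * ‖g - β • u‖ ^ 2 := by
    rw [norm_add_sq_real, inner_smul_right, real_inner_comm, inner_sub_left, inner_smul_left,
      norm_smul, mul_pow, Real.norm_eq_abs, sq_abs]
    simp only [RCLike.conj_to_real]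
    ring
  have h3 : ‖u - w‖ ^ 2 - ‖w‖ ^ 2 ≤ 2 * inner ℝ u (u - w) := by
    rw [norm_sub_sq_real, inner_sub_right, real_inner_self_eq_norm_sq]
    nlinarith [sq_nonneg ‖u‖]
  have h4 : ‖g - β • u‖ ^ 2 ≤ (2 * L) ^ 2 := by gcongr
  have h5 := mul_le_mul_of_nonneg_left h3 (mul_nonneg hγ hβ)
  have h6 := mul_le_mul_of_nonneg_left h4 (sq_nonneg γ)
  nlinarith

/-- The potential is the squared distance of the mixed multipliers to `w`, weighted by `1/γ_T = T ^
(1 - b)`. After contraction the new weight is at most the old one, so the potential telescopes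
without a bound on the multipliers. -/
lemma IsRun.sum_inner_sub_mixed_le (hA : IsCommunicationMatrix G A)
    (hL : ∀ t, 1 ≤ t → ∀ i, ∀ y ∈ Ω i, ‖(Γ t).g i y‖ ≤ L) (hL0 : 0 ≤ L) (hb : 0 ≤ b)
    (h : IsRun Ω Γ dJ dg A φ dφ α (stepsize b) (stepsize (1 - b)) x lam) {w : Vec m}
    (hw : ∀ k, 0 ≤ w k) (hb1 : b < 1) (T : ℕ) :
    2 * ∑ t ∈ Finset.Icc 1 T, ∑ i, inner ℝ ((Γ t).g i (x t i)) (w - mixed A (lam t) i)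
      + (T : ℝ) ^ (1 - b) * ∑ i, ‖mixed A (lam (T + 1)) i - w‖ ^ 2
      ≤ ∑ t ∈ Finset.Icc 1 T, (N * ‖w‖ ^ 2 * stepsize b t + 4 * N * L ^ 2 * stepsize (1 - b) t) := by
  induction T with
  -- The weight vanishes at `T = 0`, so the initial distance to `w` costs nothing.
  | zero => simp [Real.zero_rpow (by linarith : 1 - b ≠ 0)]
  | succ T ih =>
    rw [Finset.sum_Icc_succ_top (by omega), Finset.sum_Icc_succ_top (by omega)]
    have ht : 1 ≤ T + 1 := by omega
    have hγ := stepsize_pos (1 - b) ht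
    have hβ := stepsize_pos b ht
    set V := ∑ i, ‖mixed A (lam (T + 1)) i - w‖ ^ 2 with hV
    have hV0 : 0 ≤ V := Finset.sum_nonneg fun i _ => by positivity
    set Q := ∑ i, inner ℝ ((Γ (T + 1)).g i (x (T + 1) i)) (w - mixed A (lam (T + 1)) i) with hQ
    have hstep : ∑ i, ‖mixed A (lam (T + 1 + 1)) i - w‖ ^ 2 ≤
        (1 - stepsize (1 - b) (T + 1) * stepsize b (T + 1)) * V
        - 2 * stepsize (1 - b) (T + 1) * Q
        + N * (stepsize (1 - b) (T + 1) * stepsize b (T + 1) * ‖w‖ ^ 2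
          + 4 * L ^ 2 * stepsize (1 - b) (T + 1) ^ 2) := by
      refine (hA.sum_norm_mixed_sub_sq_le _ _).trans ?_
      refine (Finset.sum_le_sum fun i _ => ?_).trans (b := ∑ i,
        ((1 - stepsize (1 - b) (T + 1) * stepsize b (T + 1))
            * ‖mixed A (lam (T + 1)) i - w‖ ^ 2
          - 2 * stepsize (1 - b) (T + 1)
            * inner ℝ ((Γ (T + 1)).g i (x (T + 1) i)) (w - mixed A (lam (T + 1)) i)
          + (stepsize (1 - b) (T + 1) * stepsize b (T + 1) * ‖w‖ ^ 2
            + 4 * L ^ 2 * stepsize (1 - b) (T + 1) ^ 2))) ?_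
      · rw [h.dual (T + 1) ht i]
        have h1 := norm_dual_step_sq_le hγ.le hβ.le hw
          (h.norm_dual_direction_le hA hL hL0 hb ht i)
        have h2 : inner ℝ ((Γ (T + 1)).g i (x (T + 1) i)) (w - mixed A (lam (T + 1)) i)
            = -inner ℝ ((Γ (T + 1)).g i (x (T + 1) i)) (mixed A (lam (T + 1)) i - w) := by
          rw [← inner_neg_right, neg_sub]
        rw [h2]
        linarith
      · rw [Finset.sum_add_distrib, Finset.sum_sub_distrib, ← Finset.mul_sum, ← Finset.mul_sum]
        simp only [Finset.sum_const, Finset.card_univ, Fintype.card_fin, nsmul_eq_mul]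
        exact le_rfl
    have hinv : stepsize (1 - b) (T + 1) * ((T + 1 : ℕ) : ℝ) ^ (1 - b) = 1 :=
      stepsize_mul_rpow (1 - b) ht
    set γ' := stepsize (1 - b) (T + 1)
    set P := ((T + 1 : ℕ) : ℝ) ^ (1 - b) with hP
    have hP0 : 0 ≤ P := by positivity
    have hstep' := mul_le_mul_of_nonneg_left hstep hP0
    have hP1 : P - stepsize b (T + 1) ≤ (T : ℝ) ^ (1 - b) := by
      have := rpow_neg_sub_le hb (t := ((T + 1 : ℕ) : ℝ))
        (by push_cast; linarith [Nat.cast_nonneg (α := ℝ) T])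
      have e1 : ((T + 1 : ℕ) : ℝ) - 1 = T := by push_cast; ring
      rw [e1] at this
      rwa [stepsize_eq b ht]
    have hP2 := mul_le_mul_of_nonneg_right hP1 hV0
    have e : P * ((1 - γ' * stepsize b (T + 1)) * V - 2 * γ' * Q
        + N * (γ' * stepsize b (T + 1) * ‖w‖ ^ 2 + 4 * L ^ 2 * γ' ^ 2))
        = (P - (γ' * P) * stepsize b (T + 1)) * V - 2 * (γ' * P) * Q
        + N * ((γ' * P) * stepsize b (T + 1) * ‖w‖ ^ 2 + 4 * L ^ 2 * γ' * (γ' * P)) := by ring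
    rw [e, hinv] at hstep'
    linarith

end Run

/-! ### Weighted telescoping, norm bounds and the primal step -/

lemma sum_sub_div_stepsize_le {D : ℕ → ℝ} {B b : ℝ} (hb : 0 ≤ b)
    (hD0 : ∀ t, 1 ≤ t → 0 ≤ D t) (hDB : ∀ t, 1 ≤ t → D t ≤ B) (T : ℕ) :
    ∑ t ∈ Finset.Icc 1 T, (D t - D (t + 1)) / stepsize b t ≤ B * (T : ℝ) ^ b := by
  -- Keeping the last term makes the induction close: raising the weight from `T ^ b` to `(T + 1) ^
  -- b` costs `D (T + 1)` times the increase, and `D (T + 1) ≤ B`.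
  have key : ∑ t ∈ Finset.Icc 1 T, (D t - D (t + 1)) / stepsize b t + D (T + 1) * (T : ℝ) ^ b
      ≤ B * (T : ℝ) ^ b := by
    induction T with
    | zero =>
      simp only [Finset.Icc_eq_empty_of_lt zero_lt_one, Finset.sum_empty, zero_add]
      exact mul_le_mul_of_nonneg_right (hDB 1 le_rfl) (by positivity)
    | succ T ih =>
      rw [Finset.sum_Icc_succ_top (by omega)]
      have ht : 1 ≤ T + 1 := by omega
      have e : (D (T + 1) - D (T + 1 + 1)) / stepsize b (T + 1)
          = (D (T + 1) - D (T + 1 + 1)) * ((T + 1 : ℕ) : ℝ) ^ b := by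
        rw [div_eq_iff (stepsize_pos b ht).ne', mul_assoc, mul_comm (_ ^ b),
          stepsize_mul_rpow b ht, mul_one]
      rw [e]
      have h1 : (T : ℝ) ^ b ≤ ((T + 1 : ℕ) : ℝ) ^ b :=
        Real.rpow_le_rpow (by positivity) (by push_cast; linarith) hb
      have h2 := mul_le_mul_of_nonneg_left h1 (sub_nonneg.2 (hDB _ ht))
      linarith
  have : 0 ≤ D (T + 1) * (T : ℝ) ^ b := mul_nonneg (hD0 _ (by omega)) (by positivity)
  linarith

lemma abs_apply_le_norm (v : Vec m) (j : Fin m) : |v j| ≤ ‖v‖ := PiLp.norm_apply_le v j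

lemma norm_primal_direction_le {k : ℕ} {v : Vec k} {d : Fin m → Vec k} {u : Vec m} {M B : ℝ}
    (hv : ‖v‖ ≤ M) (hd : ∀ j, ‖d j‖ ≤ M) (hu : ‖u‖ ≤ B) :
    ‖v + ∑ j, u j • d j‖ ≤ M + m * (B * M) := by
  refine (norm_add_le _ _).trans (add_le_add hv ?_)
  calc ‖∑ j, u j • d j‖ ≤ ∑ j : Fin m, B * M := by
        refine (norm_sum_le _ _).trans (Finset.sum_le_sum fun j _ => ?_)
        rw [norm_smul]
        exact mul_le_mul ((abs_apply_le_norm u j).trans hu) (hd j) (norm_nonneg _)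
          ((norm_nonneg _).trans hu)
    _ = m * (B * M) := by simp

lemma norm_sub_le_of_mem_prodSet {Ω : ∀ i : Fin N, Set (Vec (n i))} {L : ℝ}
    (hL : ∀ i, ∀ y ∈ Ω i, ‖y‖ < L) {x y : Joint n} (hx : x ∈ prodSet Ω) (hy : y ∈ prodSet Ω) :
    ‖x - y‖ ≤ √(N * (2 * L) ^ 2) := by
  rw [PiLp.norm_eq_of_L2]
  apply Real.sqrt_le_sqrt
  refine (Finset.sum_le_sum (g := fun _ => (2 * L) ^ 2) fun i _ => ?_).trans (by simp)
  have : ‖(x - y) i‖ ≤ 2 * L := by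
    have h : ‖x i - y i‖ ≤ ‖x i‖ + ‖y i‖ := norm_sub_le _ _
    rw [PiLp.sub_apply]
    linarith [hL i _ (hx i), hL i _ (hy i)]
  gcongr

lemma norm_averagedPlay_sub_sq_le (x : ℕ → Joint n) (y : Joint n) {T : ℕ} (hT : 1 ≤ T) :
    ‖averagedPlay x T - y‖ ^ 2 ≤ 1 / (T : ℝ) * ∑ t ∈ Finset.Icc 1 T, ‖x t - y‖ ^ 2 := by
  have hconv : ConvexOn ℝ Set.univ (fun v : Joint n => ‖v‖ ^ 2) :=
    convexOn_univ_norm.pow (fun _ _ => norm_nonneg _) 2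
  have e : averagedPlay x T - y = ∑ t ∈ Finset.Icc 1 T, (1 / (T : ℝ)) • (x t - y) := by
    simp only [smul_sub, Finset.sum_sub_distrib, ← Finset.sum_smul, sum_Icc_one_div hT, one_smul,
      averagedPlay_eq]
  rw [e, Finset.mul_sum]
  exact hconv.map_sum_le (fun _ _ => by positivity) (sum_Icc_one_div hT)
    (fun _ _ => Set.mem_univ _)

section Run

variable {A : Matrix (Fin N) (Fin N) ℝ}
  {Ω : ∀ i : Fin N, Set (Vec (n i))} {Γ : ℕ → Game n m}
  {dJ : ℕ → ∀ i : Fin N, Joint n → Vec (n i)}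
  {dg : ℕ → ∀ i : Fin N, Fin m → Vec (n i) → Vec (n i)}
  {φ : ∀ i : Fin N, Vec (n i) → ℝ} {dφ : ∀ i : Fin N, Vec (n i) → Vec (n i)}
  {α β γ : ℕ → ℝ} {x : ℕ → Joint n} {lam : ℕ → Fin N → Vec m}

/-- One step of the primal update, compared with a fixed joint action `y`. -/
lemma IsRun.primal_step (h : IsRun Ω Γ dJ dg A φ dφ α β γ x lam)
    (hΩ : ∀ i, Convex ℝ (Ω i))
    {t : ℕ} (ht : 1 ≤ t) (hα : 0 < α t) (hgconv : (Γ t).ConvexConstraints Ω)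
    (hgd : (Γ t).HasConstraintGradients Ω (dg t)) {ν : Fin N → ℝ} (hν : ∀ i, 0 < ν i)
    (hφd : ∀ i, ∀ ζ ∈ Ω i, HasGradientWithinAt (φ i) (dφ i ζ) (Ω i) ζ)
    (hφ : ∀ i, ∀ ξ ∈ Ω i, ∀ ζ ∈ Ω i,
      φ i ζ + inner ℝ (dφ i ζ) (ξ - ζ) + ν i / 2 * ‖ξ - ζ‖ ^ 2 ≤ φ i ξ)
    (hmix : ∀ i k, 0 ≤ mixed A (lam t) i k) {B : ℝ}
    (hB : ∀ i, ‖dJ t i (x t) + ∑ j, mixed A (lam t) i j • dg t i j (x t i)‖ ≤ B)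
    {y : Joint n} (hy : y ∈ prodSet Ω) :
    ∑ i, inner ℝ (x t i - y i) (dJ t i (x t))
      + ∑ i, inner ℝ (mixed A (lam t) i) ((Γ t).g i (x t i) - (Γ t).g i (y i)) ≤
    ∑ i, (bregman (φ i) (dφ i) (y i) (x t i) - bregman (φ i) (dφ i) (y i) (x (t + 1) i)) / α t
      + (∑ i, 1 / (2 * ν i)) * (α t * B ^ 2) := by
  rw [← Finset.sum_add_distrib, Finset.sum_mul, ← Finset.sum_add_distrib]
  refine Finset.sum_le_sum fun i _ => ?_
  have hxi := h.mem ht i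
  have h1 := mirror_step (hΩ i) (hν i) (hφd i) (hφ i) hα hxi (h.primal_mem t ht i) (hy i)
    (h.primal_min t ht i)
  rw [inner_add_right, inner_sum] at h1
  -- Nonnegative multipliers preserve the gradient inequalities of the convex constraint components.
  have h2 : inner ℝ (mixed A (lam t) i) ((Γ t).g i (x t i) - (Γ t).g i (y i))
      ≤ ∑ j, inner ℝ (x t i - y i) (mixed A (lam t) i j • dg t i j (x t i)) := by
    rw [PiLp.inner_apply]
    refine Finset.sum_le_sum fun j _ => ?_
    have h3 := gradient_inequality (hgconv i j) (hgd i j _ hxi) hxi (hy i)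
    have h4 : inner ℝ (x t i - y i) (dg t i j (x t i))
        = -inner ℝ (dg t i j (x t i)) (y i - x t i) := by
      rw [← inner_neg_right, neg_sub, real_inner_comm]
    rw [inner_smul_right, h4, real_inner_comm]
    simp only [PiLp.sub_apply, RCLike.inner_apply, RCLike.conj_to_real]
    have h5 := mul_le_mul_of_nonneg_left h3 (hmix i j)
    linarith
  have h6 : α t * ‖dJ t i (x t) + ∑ j, mixed A (lam t) i j • dg t i j (x t i)‖ ^ 2 / (2 * ν i)
      ≤ 1 / (2 * ν i) * (α t * B ^ 2) := by
    rw [div_eq_mul_one_div, mul_comm]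
    have := hν i
    gcongr
    exact hB i
  linarith

end Run

end OnlineGame
end

/-! ### Assembly of the estimates into the rate -/

theorem theorem3 {N : ℕ} {n : Fin N → ℕ} {m : ℕ}
    -- the communication graph and its weights
    (G : SimpleGraph (Fin N)) (A : Matrix (Fin N) (Fin N) ℝ)
    (hA : OnlineGame.IsCommunicationMatrix G A)
    -- the online game, with the gradients of its costs and constraints
    (Ω : ∀ i : Fin N, Set (OnlineGame.Vec (n i)))
    (Γ : ℕ → OnlineGame.Game n m)
    (dJ : ℕ → ∀ i : Fin N, OnlineGame.Joint n → OnlineGame.Vec (n i))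
    (dg : ℕ → ∀ i : Fin N, Fin m → OnlineGame.Vec (n i) → OnlineGame.Vec (n i))
    (hΓ : OnlineGame.BlanketAssumption Ω Γ dJ dg)
    -- the mirror maps
    (φ : ∀ i : Fin N, OnlineGame.Vec (n i) → ℝ)
    (dφ : ∀ i : Fin N, OnlineGame.Vec (n i) → OnlineGame.Vec (n i))
    (hφ : OnlineGame.IsMirrorMap Ω φ dφ)
    (hD : OnlineGame.BregmanLipschitz Ω φ dφ)
    -- the limit game: convex differentiable costs, strong monotonicity, Slater's condition
    (Γlim : OnlineGame.Game n m)
    (dJlim : ∀ i : Fin N, OnlineGame.Joint n → OnlineGame.Vec (n i))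
    (hJconv : Γlim.ConvexCosts Ω)
    (hJdiff : Γlim.HasCostGradients Ω dJlim)
    (μ : ℝ) (hμ : 0 < μ)
    (hmono : OnlineGame.StronglyMonotoneOn (OnlineGame.pseudoGradient dJlim)
      (OnlineGame.prodSet Ω) μ)
    (hslater : Γlim.Slater Ω)
    -- the rates of convergence of the online game to its limit
    (p q : ℝ) (hp : 0 < p) (hq : 0 < q)
    (hH : ∀ i, OnlineGame.HasRate (fun t => OnlineGame.gradGap Ω (dJ t) dJlim i) p)
    (hK : OnlineGame.HasRate (fun t => OnlineGame.constraintGap Ω (Γ t) Γlim) q)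
    -- the exponents of the stepsizes
    (b₁ b₂ : ℝ) (hb₂ : 0 < 2 * b₂) (hb : 2 * b₂ < b₁) (hb₁ : b₁ < 1) (hbq : b₂ < q)
    -- the variational generalized Nash equilibrium of the limit game
    (xs : OnlineGame.Joint n) (hxs : Γlim.IsVariationalGNE Ω dJlim xs) :
    ∃ C : ℝ, 0 < C ∧
      ∀ (x : ℕ → OnlineGame.Joint n) (lam : ℕ → Fin N → OnlineGame.Vec m),
        OnlineGame.IsRun Ω Γ dJ dg A φ dφ
          (OnlineGame.stepsize b₁) (OnlineGame.stepsize b₂) (OnlineGame.stepsize (1 - b₂)) x lam →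
        ∀ T : ℕ, 1 ≤ T →
          ‖OnlineGame.averagedPlay x T - xs‖ ^ 2 ≤
            C * (T : ℝ) ^ (-(min (1 - b₁) (min (b₁ - 2 * b₂) (min b₂ (min p (q - b₂)))))) := by
  set r := min (1 - b₁) (min (b₁ - 2 * b₂) (min b₂ (min p (q - b₂)))) with hr
  have hr1 : r ≤ 1 - b₁ := min_le_left _ _
  have hr2 : r ≤ b₁ - 2 * b₂ := (min_le_right _ _).trans (min_le_left _ _)
  have hr3 : r ≤ b₂ := (min_le_right _ _).trans ((min_le_right _ _).trans (min_le_left _ _))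
  have hr4 : r ≤ p := (min_le_right _ _).trans ((min_le_right _ _).trans
    ((min_le_right _ _).trans (min_le_left _ _)))
  have hr5 : r ≤ q - b₂ := (min_le_right _ _).trans ((min_le_right _ _).trans
    ((min_le_right _ _).trans (min_le_right _ _)))
  have hr0 : 0 < r := by
    simp only [hr, lt_min_iff]
    refine ⟨?_, ?_, ?_, ?_, ?_⟩ <;> linarith
  clear_value r
  have hb20 : 0 ≤ b₂ := by linarith
  obtain ⟨L, hL, hLy, -, hLg⟩ := hΓ.bounded
  obtain ⟨M, hM, hMJ, hMg⟩ := hΓ.bounded_gradients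
  obtain ⟨σ, -, hσ1, hσ⟩ := hA.exists_norm_dev_mixed_le (m := m)
  obtain ⟨i₀⟩ := hA.connected.nonempty
  choose CJ hCJ0 hCJ using fun i => (hH i).exists_norm_grad_sub_le
  obtain ⟨CK, hCK0, hCK⟩ := hK.exists_norm_gSum_sub_le
  choose hφd ν hν hφs using hφ
  obtain ⟨K, hK0, hKD⟩ := hD
  have hX := OnlineGame.convex_prodSet hΓ.convex
  have hxsX : xs ∈ OnlineGame.prodSet Ω := hxs.1.1
  obtain ⟨Λ, hΛ0, hΛ⟩ := Γlim.exists_bounded_multiplier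
    (OnlineGame.convexOn_gSum_limit hΓ.convex hΓ.convex_constraints hq hCK) hX
    (fun x hx y hy => OnlineGame.norm_sub_le_of_mem_prodSet hLy hx hy) hslater hxs.2
  set BG := M + m * (L * M) with hBG
  set c₁ := (∑ i, 1 / (2 * ν i)) * BG ^ 2 + 2 * L * ∑ i, CJ i + L * CK with hc₁
  set c₂ := N * Λ ^ 2 / 2 + 2 * N * L ^ 2 with hc₂
  set c₃ := 2 * N * (2 * L) / (1 - σ) with hc₃
  set c₄ := c₁ + c₂ + N * L * c₃ + Λ * CK with hc₄
  set C₀ := (N * (K * (2 * L)) + c₄ * (1 / (1 - r))) / μ with hC₀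
  have hC₀0 : 0 ≤ C₀ := by
    have h1 : 0 ≤ ∑ i, 1 / (2 * ν i) := Finset.sum_nonneg fun i _ => by
      have := hν i; positivity
    have h2 : 0 ≤ ∑ i, CJ i := Finset.sum_nonneg fun i _ => hCJ0 i
    have h3 : 0 < 1 - σ := by linarith
    have h4 : 0 < 1 - r := by linarith
    positivity
  -- `C₀` is only known to be nonnegative; adding one makes the constant positive.
  refine ⟨C₀ + 1, by linarith, fun x lam hrun T hT => ?_⟩
  have hT0 : (0 : ℝ) < T := by exact_mod_cast hT
  -- The multiplier is chosen after the run and `T`; only its uniform bound `Λ` enters the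
  -- constants.
  obtain ⟨l, hl0, hlΛ, hl⟩ := hΛ x (fun t ht => hrun.mem ht) T hT
  set R : ℕ → ℝ := fun t => (t : ℝ) ^ (-r) with hR
  set u : ℕ → Fin N → OnlineGame.Vec m := fun t => OnlineGame.mixed A (lam t) with hu
  set D : Fin N → ℕ → ℝ := fun i t => OnlineGame.bregman (φ i) (dφ i) (xs i) (x t i) with hDdef
  set F := OnlineGame.pseudoGradient dJlim xs with hF
  have hstep : ∀ t ∈ Finset.Icc 1 T,
      μ * ‖x t - xs‖ ^ 2 + inner ℝ F (x t - xs) + ∑ i, inner ℝ ((Γ t).g i (x t i)) (u t i) ≤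
        ∑ i, (D i t - D i (t + 1)) / OnlineGame.stepsize b₁ t + c₁ * R t
          + N * L * ‖OnlineGame.dev (lam t)‖ := by
    intro t ht
    have ht1 := (Finset.mem_Icc.1 ht).1
    have ht0 : (0 : ℝ) < t := by exact_mod_cast ht1
    have htge : (1 : ℝ) ≤ t := by exact_mod_cast ht1
    have hmem := hrun.mem ht1
    have hlam := hrun.norm_lam_le hA hLg hL.le hb20 ht1
    have hmix := hA.mixed_nonneg (fun i k => hrun.lam_nonneg ht1 i k)
    have hpow1 : 1 ≤ (t : ℝ) ^ b₂ := Real.one_le_rpow htge hb20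
    have hdir : ∀ i, ‖dJ t i (x t) + ∑ j, u t i j • dg t i j (x t i)‖ ≤ BG * (t : ℝ) ^ b₂ := by
      intro i
      refine (OnlineGame.norm_primal_direction_le (hMJ t ht1 i _ hmem)
        (fun j => hMg t ht1 i j _ (hmem i)) (hA.norm_mixed_le hlam i)).trans ?_
      have := mul_le_mul_of_nonneg_left hpow1 hM.le
      rw [hBG]
      linarith
    have hprim := hrun.primal_step hΓ.convex ht1 (OnlineGame.stepsize_pos b₁ ht1)
      (hΓ.convex_constraints t ht1) (hΓ.constraint_gradients t ht1) hν hφd hφs hmix hdir hxsX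
    have hα : OnlineGame.stepsize b₁ t * (BG * (t : ℝ) ^ b₂) ^ 2 ≤ BG ^ 2 * R t := by
      have e : OnlineGame.stepsize b₁ t * (BG * (t : ℝ) ^ b₂) ^ 2
          = BG ^ 2 * (t : ℝ) ^ (-(b₁ - 2 * b₂)) := by
        rw [OnlineGame.stepsize_eq b₁ ht1, mul_pow, ← Real.rpow_mul_natCast ht0.le, mul_left_comm,
          ← Real.rpow_add ht0]
        congr 2
        push_cast
        ring
      rw [e]
      exact mul_le_mul_of_nonneg_left (OnlineGame.rpow_neg_anti hr2 ht1) (sq_nonneg _)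
    have hν0 : 0 ≤ ∑ i, 1 / (2 * ν i) := Finset.sum_nonneg fun i _ => by
      have := hν i; positivity
    have hα' := mul_le_mul_of_nonneg_left hα hν0
    -- the costs
    have hcost : μ * ‖x t - xs‖ ^ 2 + inner ℝ F (x t - xs) - 2 * L * (∑ i, CJ i) * R t
        ≤ ∑ i, inner ℝ (x t i - xs i) (dJ t i (x t)) := by
      have h1 := hmono (x t) hmem xs hxsX
      rw [inner_sub_left] at h1
      have h2 : inner ℝ (OnlineGame.pseudoGradient dJlim (x t)) (x t - xs)
          = ∑ i, inner ℝ (x t i - xs i) (dJlim i (x t)) := by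
        rw [PiLp.inner_apply]
        exact Finset.sum_congr rfl fun i _ => real_inner_comm _ _
      have h3 : ∑ i, inner ℝ (x t i - xs i) (dJlim i (x t)) - 2 * L * (∑ i, CJ i) * R t
          ≤ ∑ i, inner ℝ (x t i - xs i) (dJ t i (x t)) := by
        rw [Finset.mul_sum, Finset.sum_mul, ← Finset.sum_sub_distrib]
        refine Finset.sum_le_sum fun i _ => ?_
        have h4 : inner ℝ (x t i - xs i) (dJlim i (x t)) - inner ℝ (x t i - xs i) (dJ t i (x t))
            ≤ ‖x t i - xs i‖ * ‖dJ t i (x t) - dJlim i (x t)‖ := by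
          rw [← inner_sub_right, norm_sub_rev (dJ t i (x t))]
          exact real_inner_le_norm _ _
        have h5 : ‖x t i - xs i‖ ≤ 2 * L := by
          refine (norm_sub_le _ _).trans ?_
          linarith [hLy i _ (hmem i), hLy i _ (hxsX i)]
        have h6 : ‖dJ t i (x t) - dJlim i (x t)‖ ≤ CJ i * R t :=
          (hCJ i t ht1 _ hmem).trans
            (mul_le_mul_of_nonneg_left (OnlineGame.rpow_neg_anti hr4 ht1) (hCJ0 i))
        have h7 := mul_le_mul h5 h6 (norm_nonneg _) (by linarith)
        linarith
      linarith
    -- the constraints at the equilibrium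
    have hcon : ∑ i, inner ℝ (u t i) ((Γ t).g i (xs i))
        ≤ N * L * ‖OnlineGame.dev (lam t)‖ + L * CK * R t := by
      have h1 : ∑ i, inner ℝ (u t i) ((Γ t).g i (xs i))
          = ∑ i, inner ℝ (OnlineGame.dev (u t) i) ((Γ t).g i (xs i))
            + inner ℝ (OnlineGame.avg (lam t)) ((Γ t).gSum xs) := by
        rw [OnlineGame.Game.gSum, inner_sum, ← Finset.sum_add_distrib]
        refine Finset.sum_congr rfl fun i _ => ?_
        rw [← inner_add_left, OnlineGame.dev_apply, hA.avg_mixed, sub_add_cancel]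
      have h2 : ∑ i, inner ℝ (OnlineGame.dev (u t) i) ((Γ t).g i (xs i))
          ≤ N * L * ‖OnlineGame.dev (lam t)‖ := by
        have h3 : ‖OnlineGame.dev (u t)‖ ≤ ‖OnlineGame.dev (lam t)‖ :=
          (hσ _).trans (mul_le_of_le_one_left (norm_nonneg _) hσ1.le)
        refine (Finset.sum_le_sum (g := fun _ => L * ‖OnlineGame.dev (lam t)‖)
          fun i _ => ?_).trans (by simp [mul_assoc])
        refine (real_inner_le_norm _ _).trans ?_
        rw [mul_comm]
        exact mul_le_mul (hLg t ht1 i _ (hxsX i))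
          ((PiLp.norm_apply_le (OnlineGame.dev (u t)) i).trans h3) (norm_nonneg _) hL.le
      have h4 : inner ℝ (OnlineGame.avg (lam t)) ((Γ t).gSum xs) ≤ L * CK * R t := by
        have h5 : inner ℝ (OnlineGame.avg (lam t)) (Γlim.gSum xs) ≤ 0 := by
          rw [PiLp.inner_apply]
          refine Finset.sum_nonpos fun k _ => ?_
          simp only [RCLike.inner_apply, RCLike.conj_to_real]
          exact mul_nonpos_of_nonpos_of_nonneg (hxs.1.2 k)
            (OnlineGame.avg_nonneg (fun i k => hrun.lam_nonneg ht1 i k) k)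
        have h6 : inner ℝ (OnlineGame.avg (lam t)) ((Γ t).gSum xs - Γlim.gSum xs)
            ≤ (L * (t : ℝ) ^ b₂) * (CK * (t : ℝ) ^ (-q)) :=
          (real_inner_le_norm _ _).trans (mul_le_mul (OnlineGame.norm_avg_le i₀.pos hlam)
            (hCK t ht1 xs hxsX) (norm_nonneg _) (by positivity))
        have h7 : (t : ℝ) ^ b₂ * (t : ℝ) ^ (-q) ≤ R t := by
          rw [← Real.rpow_add ht0, show b₂ + -q = -(q - b₂) by ring]
          exact OnlineGame.rpow_neg_anti hr5 ht1
        have h8 := mul_le_mul_of_nonneg_left h7 (mul_nonneg hL.le hCK0)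
        rw [inner_sub_right] at h6
        linarith
      linarith
    have hsplit : ∑ i, inner ℝ (u t i) ((Γ t).g i (x t i) - (Γ t).g i (xs i))
        = ∑ i, inner ℝ ((Γ t).g i (x t i)) (u t i) - ∑ i, inner ℝ (u t i) ((Γ t).g i (xs i)) := by
      simp only [inner_sub_right, Finset.sum_sub_distrib]
      congr 1
      exact Finset.sum_congr rfl fun i _ => real_inner_comm _ _
    rw [hsplit] at hprim
    simp only [hDdef]
    rw [hc₁]
    linarith
  -- the limit constraint against the online one
  have hgap : ∀ t ∈ Finset.Icc 1 T, inner ℝ l (Γlim.gSum (x t))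
      ≤ ∑ i, inner ℝ ((Γ t).g i (x t i)) l + Λ * CK * R t := by
    intro t ht
    have ht1 := (Finset.mem_Icc.1 ht).1
    have h1 : ∑ i, inner ℝ ((Γ t).g i (x t i)) l = inner ℝ l ((Γ t).gSum (x t)) := by
      rw [OnlineGame.Game.gSum, inner_sum]
      exact Finset.sum_congr rfl fun i _ => real_inner_comm _ _
    have h2 : inner ℝ l (Γlim.gSum (x t) - (Γ t).gSum (x t)) ≤ Λ * (CK * R t) := by
      refine (real_inner_le_norm _ _).trans (mul_le_mul hlΛ ?_ (norm_nonneg _) hΛ0)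
      rw [norm_sub_rev]
      exact (hCK t ht1 _ (hrun.mem ht1)).trans (mul_le_mul_of_nonneg_left
        (OnlineGame.rpow_neg_anti (by linarith) ht1) hCK0)
    rw [inner_sub_right] at h2
    linarith
  have hγR : ∀ t ∈ Finset.Icc 1 T, OnlineGame.stepsize (1 - b₂) t ≤ R t := fun t ht => by
    have ht1 := (Finset.mem_Icc.1 ht).1
    rw [OnlineGame.stepsize_eq _ ht1]
    exact OnlineGame.rpow_neg_anti (by linarith) ht1
  have hβR : ∀ t ∈ Finset.Icc 1 T, OnlineGame.stepsize b₂ t ≤ R t := fun t ht => by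
    have ht1 := (Finset.mem_Icc.1 ht).1
    rw [OnlineGame.stepsize_eq _ ht1]
    exact OnlineGame.rpow_neg_anti hr3 ht1
  have hdual : ∑ t ∈ Finset.Icc 1 T, ∑ i, inner ℝ ((Γ t).g i (x t i)) (l - u t i)
      ≤ c₂ * ∑ t ∈ Finset.Icc 1 T, R t := by
    have h1 := hrun.sum_inner_sub_mixed_le hA hLg hL.le hb20 hl0 (by linarith) T
    have h2 : 0 ≤ (T : ℝ) ^ (1 - b₂) * ∑ i, ‖OnlineGame.mixed A (lam (T + 1)) i - l‖ ^ 2 :=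
      mul_nonneg (by positivity) (Finset.sum_nonneg fun i _ => by positivity)
    have h3 : ∑ t ∈ Finset.Icc 1 T, (N * ‖l‖ ^ 2 * OnlineGame.stepsize b₂ t
        + 4 * N * L ^ 2 * OnlineGame.stepsize (1 - b₂) t)
        ≤ 2 * (c₂ * ∑ t ∈ Finset.Icc 1 T, R t) := by
      rw [Finset.mul_sum, Finset.mul_sum]
      refine Finset.sum_le_sum fun t ht => ?_
      have ht1 := (Finset.mem_Icc.1 ht).1
      have h4 : N * ‖l‖ ^ 2 * OnlineGame.stepsize b₂ t ≤ N * Λ ^ 2 * R t := by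
        have := (OnlineGame.stepsize_pos b₂ ht1).le
        have := hβR t ht
        gcongr
      have h5 := mul_le_mul_of_nonneg_left (hγR t ht) (by positivity : 0 ≤ 4 * N * L ^ 2)
      rw [hc₂]
      linarith
    linarith
  have hdev : ∑ t ∈ Finset.Icc 1 T, ‖OnlineGame.dev (lam t)‖
      ≤ c₃ * ∑ t ∈ Finset.Icc 1 T, R t := by
    have h1 := hrun.sum_norm_dev_le hA hLg hL.le hb20 hσ T
    have h2 := mul_le_mul_of_nonneg_left (Finset.sum_le_sum hγR)
      (by positivity : 0 ≤ 2 * N * (2 * L))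
    have h3 : 0 < 1 - σ := by linarith
    rw [hc₃, div_mul_eq_mul_div, le_div_iff₀ h3]
    linarith [norm_nonneg (OnlineGame.dev (lam (T + 1)))]
  have hbreg : ∑ t ∈ Finset.Icc 1 T, ∑ i, (D i t - D i (t + 1)) / OnlineGame.stepsize b₁ t
      ≤ N * (K * (2 * L)) * (T : ℝ) ^ b₁ := by
    rw [Finset.sum_comm]
    refine (Finset.sum_le_sum (g := fun _ => K * (2 * L) * (T : ℝ) ^ b₁) fun i _ => ?_).trans
      (by simp [mul_assoc])
    refine OnlineGame.sum_sub_div_stepsize_le (by linarith) (fun t ht => ?_) (fun t ht => ?_) T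
    · exact OnlineGame.bregman_nonneg (hν i) (hφs i) (hrun.mem ht i) (hxsX i)
    -- The divergence of a point from itself vanishes, so Lipschitz continuity in the first variable
    -- bounds `D i t` by `K` times a distance.
    · have h1 := hKD i _ (hrun.mem ht i) _ (hxsX i) _ (hrun.mem ht i)
      have h2 : OnlineGame.bregman (φ i) (dφ i) (x t i) (x t i) = 0 := by
        simp [OnlineGame.bregman]
      rw [h2, sub_zero] at h1
      refine (le_abs_self _).trans (h1.trans (mul_le_mul_of_nonneg_left ?_ hK0.le))
      refine (norm_sub_le _ _).trans ?_
      linarith [hLy i _ (hrun.mem ht i), hLy i _ (hxsX i)]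
  have hsum := Finset.sum_le_sum hstep
  have hsumgap := Finset.sum_le_sum hgap
  simp only [inner_sub_right, Finset.sum_sub_distrib] at hdual
  simp only [Finset.sum_add_distrib, ← Finset.mul_sum] at hsum hsumgap hl
  have hNL : 0 ≤ N * L := by positivity
  have hdev' := mul_le_mul_of_nonneg_left hdev hNL
  have hRsum := OnlineGame.sum_rpow_neg_le hr0.le (by linarith) T (r := r)
  have hTb : (T : ℝ) ^ b₁ ≤ (T : ℝ) ^ (1 - r) :=
    Real.rpow_le_rpow_of_exponent_le (by exact_mod_cast hT) (by linarith)
  have hc₄0 : 0 ≤ c₄ := by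
    have h1 : 0 ≤ ∑ i, 1 / (2 * ν i) := Finset.sum_nonneg fun i _ => by
      have := hν i; positivity
    have h2 : 0 ≤ ∑ i, CJ i := Finset.sum_nonneg fun i _ => hCJ0 i
    have h3 : 0 < 1 - σ := by linarith
    positivity
  have htotal : μ * ∑ t ∈ Finset.Icc 1 T, ‖x t - xs‖ ^ 2 ≤ μ * (C₀ * (T : ℝ) ^ (1 - r)) := by
    have h1 : μ * (C₀ * (T : ℝ) ^ (1 - r))
        = N * (K * (2 * L)) * (T : ℝ) ^ (1 - r) + c₄ * (1 / (1 - r) * (T : ℝ) ^ (1 - r)) := by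
      rw [hC₀]; field_simp
    have h2 := mul_le_mul_of_nonneg_left hTb (by positivity : 0 ≤ N * (K * (2 * L)))
    have h3 := mul_le_mul_of_nonneg_left hRsum hc₄0
    have h4 : c₄ * ∑ t ∈ Finset.Icc 1 T, R t = c₁ * ∑ t ∈ Finset.Icc 1 T, R t
        + c₂ * ∑ t ∈ Finset.Icc 1 T, R t + N * L * (c₃ * ∑ t ∈ Finset.Icc 1 T, R t)
        + Λ * CK * ∑ t ∈ Finset.Icc 1 T, R t := by rw [hc₄]; ring
    rw [h1]
    linarith
  have hfin := le_of_mul_le_mul_left htotal hμ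
  have hTr : 1 / (T : ℝ) * (T : ℝ) ^ (1 - r) = (T : ℝ) ^ (-r) := by
    rw [one_div, ← Real.rpow_neg_one, ← Real.rpow_add hT0]
    congr 1; ring
  calc ‖OnlineGame.averagedPlay x T - xs‖ ^ 2
      ≤ 1 / (T : ℝ) * ∑ t ∈ Finset.Icc 1 T, ‖x t - xs‖ ^ 2 :=
        OnlineGame.norm_averagedPlay_sub_sq_le x xs hT
    _ ≤ 1 / (T : ℝ) * (C₀ * (T : ℝ) ^ (1 - r)) := by gcongr
    _ = C₀ * (T : ℝ) ^ (-r) := by rw [mul_left_comm, hTr]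
    _ ≤ (C₀ + 1) * (T : ℝ) ^ (-r) := by
        have : 0 ≤ (T : ℝ) ^ (-r) := by positivity
        linarith
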